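/- Let $K$ be a commutative ring containing $\mathbb Q$, and let $\Lambda=K[p_1,p_2,p_3,\dots]$ be the ring of symmetric functions over $K$, where $p_r=\sum_i x_i^r$ are the power sums. For a partition $\lambda$ let $s_\lambda\in\Lambda$ be the Schur function, $\lambda'$ the conjugate partition, and write $f[g]$ for plethysm: for $g=g(p_1,p_2,\dots)$ with rational coefficients, $p_r[g]=g(p_r,p_{2r},p_{3r},\dots)$, and $f[g]$ is obtained from $f\in\Lambda$ by replacing each $p_r$ by $p_r[g]$. A partition $\lambda$ is called *even* if all columns of its Young diagram have even length, and *threshold* if $\lambda'_i=\lambda_i+1$ for all $1\le i\le d(\lambda)$, where $d(\lambda)$ is the largest $i$ such that the cell $(i,i)$ belongs to $\lambda$ (and $d(\lambda)=0$ if $\lambda$ is empty). **Theorem.** For every integer $h\ge 0$, $$s_h[s_2]=\sum_{\substack{\lambda\vdash 2h\\ \lambda\text{ even}}}s_{\lambda'},\qquad s_h[s_{1^2}]=\sum_{\substack{\lambda\vdash 2h\\ \lambda\text{ even}}}s_{\lambda},$$ $$s_{1^h}[s_2]=\sum_{\substack{\lambda\vdash 2h\\ \lambda\text{ threshold}}}s_{\lambda'},\qquad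 s_{1^h}[s_{1^2}]=\sum_{\substack{\lambda\vdash 2h\\ \lambda\text{ threshold}}}s_{\lambda}.$$ -/

import Mathlib

noncomputable section

namespace SymmFunc

open MvPolynomial

/-! ### Partitions

Partitions are Young diagrams (English convention, cells `(row, column)` indexed from `0`), so
`μ.rowLen i` is the part `μ_{i+1}` and `μ.colLen j` is the part `μ'_{j+1}` of the conjugate
partition `μ' = μ.transpose`. -/

theorem finite_card_eq (n : ℕ) : {μ : YoungDiagram | μ.card = n}.Finite := by
  refine Set.Finite.of_finite_image (f := YoungDiagram.cells)
    (((Finset.range n ×ˢ Finset.range n).powerset.finite_toSet).subset ?_) ?_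
  · rintro _ ⟨μ, hμ, rfl⟩
    have hμ : μ.cells.card = n := hμ
    simp only [Finset.coe_powerset, Set.mem_preimage, Set.mem_powerset_iff, Finset.coe_subset]
    rintro ⟨i, j⟩ hc
    have hc : (i, j) ∈ μ := hc
    have h1 : μ.rowLen i ≤ n := by
      rw [YoungDiagram.rowLen_eq_card, ← hμ]
      exact Finset.card_le_card (Finset.filter_subset _ _)
    have h2 : μ.colLen j ≤ n := by
      rw [YoungDiagram.colLen_eq_card, ← hμ]
      exact Finset.card_le_card (Finset.filter_subset _ _)
    have h3 := YoungDiagram.mem_iff_lt_rowLen.1 hc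
    have h4 := YoungDiagram.mem_iff_lt_colLen.1 hc
    simp only [Finset.mem_product, Finset.mem_range]
    omega
  · intro μ _ ν _ h
    exact YoungDiagram.ext h

/-- The finite set of all partitions of `n`. -/
def partitionsOf (n : ℕ) : Finset YoungDiagram := (finite_card_eq n).toFinset

@[simp]
theorem mem_partitionsOf {n : ℕ} {μ : YoungDiagram} : μ ∈ partitionsOf n ↔ μ.card = n := by
  simp [partitionsOf]

/-- The one-row partition `(h)` (the empty partition if `h = 0`). -/
def rowShape (h : ℕ) : YoungDiagram :=
  YoungDiagram.ofRowLens [h] (List.pairwise_singleton _ h).sortedGE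

/-- The one-column partition `(1^h)` (the empty partition if `h = 0`). -/
def colShape (h : ℕ) : YoungDiagram :=
  YoungDiagram.ofRowLens (List.replicate h 1) (List.Pairwise.sortedGE (by simp [List.pairwise_replicate]))

/-- A partition is even if all its columns have even length. -/
def IsEven (μ : YoungDiagram) : Prop := ∀ j, Even (μ.colLen j)

/-- A partition is threshold if `μ'_i = μ_i + 1` for every diagonal cell `(i, i)` of `μ`. -/
def IsThreshold (μ : YoungDiagram) : Prop := ∀ i, (i, i) ∈ μ → μ.colLen i = μ.rowLen i + 1

/-! ### The ring of symmetric functions and plethysm -/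

/-- The ring of symmetric functions `Λ = K[p₁, p₂, p₃, …]`; the power sum `p_r` is `X r`. -/
abbrev SymmRing (K : Type*) [CommRing K] : Type _ := MvPolynomial ℕ+ K

/-- `p_r[g]`: every power sum `p_k` occurring in `g` is replaced by `p_{rk}`. -/
def powerPlethysm (r : ℕ+) : SymmRing ℚ →ₐ[ℚ] SymmRing ℚ := aeval fun k => X (r * k)

/-- The plethysm `f[g]` for `g` with rational coefficients: every power sum `p_r` occurring in `f`
is replaced by `p_r[g]`, and the coefficients of `f` are left unchanged. -/
def plethysm {K : Type*} [CommRing K] [Algebra ℚ K] (f : SymmRing K) (g : SymmRing ℚ) :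
    SymmRing K :=
  aeval (fun r => MvPolynomial.map (algebraMap ℚ K) (powerPlethysm r g)) f

/-! ### Schur functions -/

/-- Semistandard tableaux of shape `μ` with entries in `{0, …, n - 1}`. -/
def Tableau (n : ℕ) (μ : YoungDiagram) : Type :=
  {T : SemistandardYoungTableau μ // ∀ i j, (i, j) ∈ μ → T i j < n}

instance (n : ℕ) (μ : YoungDiagram) : Finite (Tableau n μ) := by
  let F : Tableau n μ → (μ.cells → Fin n) := fun T c => ⟨T.1 c.1.1 c.1.2, T.2 _ _ c.2⟩
  refine Finite.of_injective F fun T T' h => Subtype.ext ?_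
  ext i j
  by_cases hc : (i, j) ∈ μ
  · exact congrArg Fin.val (congrFun h ⟨(i, j), hc⟩)
  · rw [T.1.zeros hc, T'.1.zeros hc]

instance (n : ℕ) (μ : YoungDiagram) : Fintype (Tableau n μ) := Fintype.ofFinite _

/-- The Schur polynomial `s_μ(x_0, …, x_{n-1})`: the sum over all semistandard tableaux `T` of
shape `μ` of the product of the variables `x_{T(c)}` over the cells `c` of `μ`. -/
def schurPoly (K : Type*) [CommRing K] (n : ℕ) (μ : YoungDiagram) : MvPolynomial (Fin n) K :=
  ∑ T : Tableau n μ, ∏ c : μ.cells, X ⟨T.1 c.1.1 c.1.2, T.2 _ _ c.2⟩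

/-- The evaluation `f ↦ f(x_0, …, x_{n-1})` of symmetric functions in `n` variables: the power sum
`p_r` is sent to the power sum polynomial `x_0 ^ r + ⋯ + x_{n-1} ^ r`. -/
def evalVars (K : Type*) [CommRing K] (n : ℕ) : SymmRing K →ₐ[K] MvPolynomial (Fin n) K :=
  aeval fun r => psum (Fin n) K r

/-- The Schur function `s_μ`: the element of `Λ` which becomes the Schur polynomial of `μ` in any
number of variables (it exists and is unique when `K` contains `ℚ`). -/
def schur (K : Type*) [CommRing K] (μ : YoungDiagram) : SymmRing K :=
  Classical.epsilon fun f => ∀ n, evalVars K n f = schurPoly K n μ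

end SymmFunc

end

noncomputable section

namespace SymmFunc

open scoped Classical

/-! ### Young diagrams and row lengths -/

/-! A symmetric function is determined by its values in finitely many variables (`ext_evalVars`),
and `p_r[s_{1^2}]` evaluates to the `r`-th power sum of the products `x_i x_j`, `i < j`. So the two
identities for `s_{1^2}` are Littlewood's expansions of the complete and elementary symmetric
polynomials in these products (`littlewood`).

These are proved by induction on the number of variables. A new variable `y` adds the products `x_i
y`, hence a factor `∑ y^c h_c(x)` or `∑ y^c e_c(x)`, which acts on Schur polynomials by the Pieri
rules (`hsym_mul_schurVal`, `hsym_omegaSeq_mul_schurVal`). On the other side, `y` is split off by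
the branching rule `schurVal_succ`, which removes a horizontal strip. Comparing coefficients of a
power of `y` times `s_μ(x)` leaves a counting statement, `Balanced`: members `λ` of the family with
`λ/μ` a horizontal strip are equinumerous with members `ν` with `μ/ν` a horizontal (resp. vertical)
strip, where `|λ| + |ν| = 2|μ|`.

For even partitions, `λ` and `ν` arise from `μ` by rounding every column length up or down to an
even number, and reflection in `μ` exchanges the two. For threshold partitions, the lengths of the
rows meeting the diagonal range over independent intervals, so both counts are coefficients of
products of short polynomials; a telescoping argument shows that the products agree
(`prod_outer_eq_prod_inner`).

Complete and elementary functions are both written as `hsym`, the solution of Newton's recursion for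
a given sequence of power sums; the sign change `omegaSeq` turns one into the other. The identities
for `s_2` follow by applying the involution `omega`: it conjugates Schur functions (`omega_schur`)
and carries `f[s_{1^2}]` to `f[s_2]` (`omega_plethysm_colShape`). -/

theorem ext_mem {μ ν : YoungDiagram} (h : ∀ i j, (i, j) ∈ μ ↔ (i, j) ∈ ν) : μ = ν := by
  apply YoungDiagram.ext
  ext ⟨i, j⟩
  simpa using h i j

theorem ext_rowLen {μ ν : YoungDiagram} (h : ∀ i, μ.rowLen i = ν.rowLen i) : μ = ν :=
  ext_mem fun i j => by simp only [YoungDiagram.mem_iff_lt_rowLen, h]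

theorem ext_colLen {μ ν : YoungDiagram} (h : ∀ i, μ.colLen i = ν.colLen i) : μ = ν :=
  ext_mem fun i j => by simp only [YoungDiagram.mem_iff_lt_colLen, h]

theorem rowLen_eq_of_mem_iff {μ : YoungDiagram} {i n : ℕ} (h : ∀ j, (i, j) ∈ μ ↔ j < n) :
    μ.rowLen i = n := by
  have h1 : ∀ j, j < μ.rowLen i ↔ j < n := fun j => by rw [← YoungDiagram.mem_iff_lt_rowLen, h]
  have := h1 n
  have := h1 (μ.rowLen i)
  omega

theorem colLen_eq_of_mem_iff {μ : YoungDiagram} {j n : ℕ} (h : ∀ i, (i, j) ∈ μ ↔ i < n) :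
    μ.colLen j = n := by
  have h1 : ∀ i, i < μ.colLen j ↔ i < n := fun i => by rw [← YoungDiagram.mem_iff_lt_colLen, h]
  have := h1 n
  have := h1 (μ.colLen j)
  omega

/-- The Young diagram with row lengths `f 0 ≥ f 1 ≥ ⋯`. -/
def ofFun (f : ℕ → ℕ) (hf : Antitone f) (N : ℕ) (_hN : f N = 0) : YoungDiagram where
  cells := (Finset.range N ×ˢ Finset.range (f 0)).filter fun c => c.2 < f c.1
  isLowerSet := by
    rintro ⟨i, j⟩ ⟨i', j'⟩ ⟨hi, hj⟩ h
    simp only [Finset.coe_filter, Finset.mem_product, Finset.mem_range, Set.mem_ofPred_eq] at h ⊢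
    have : f i ≤ f i' := hf hi
    simp only at hi hj
    omega

theorem mem_ofFun {f : ℕ → ℕ} {hf : Antitone f} {N : ℕ} {hN : f N = 0} {i j : ℕ} :
    (i, j) ∈ ofFun f hf N hN ↔ j < f i := by
  rw [← YoungDiagram.mem_cells]
  simp only [ofFun, Finset.mem_filter, Finset.mem_product, Finset.mem_range, and_iff_right_iff_imp]
  intro h
  refine ⟨?_, h.trans_le (hf (Nat.zero_le i))⟩
  by_contra hc
  have := hf (not_lt.1 hc)
  omega

@[simp]
theorem rowLen_ofFun {f : ℕ → ℕ} {hf : Antitone f} {N : ℕ} {hN : f N = 0} (i : ℕ) :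
    (ofFun f hf N hN).rowLen i = f i :=
  rowLen_eq_of_mem_iff fun _ => mem_ofFun

theorem card_eq_sum_rowLen (μ : YoungDiagram) {N : ℕ} (hN : μ.rowLen N = 0) :
    μ.card = ∑ i ∈ Finset.range N, μ.rowLen i := by
  have hm : ∀ c ∈ μ.cells, c.1 ∈ Finset.range N := by
    rintro ⟨i, j⟩ h
    have h := YoungDiagram.mem_iff_lt_rowLen.1 ((YoungDiagram.mem_cells _).1 h)
    rw [Finset.mem_range]
    by_contra hc
    have := μ.rowLen_anti N i (not_lt.1 hc)
    omega
  rw [YoungDiagram.card, Finset.card_eq_sum_card_fiberwise hm]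
  refine Finset.sum_congr rfl fun i _ => ?_
  rw [YoungDiagram.rowLen_eq_card]
  rfl

@[simp]
theorem card_transpose (μ : YoungDiagram) : μ.transpose.card = μ.card := by
  refine Finset.card_bij' (fun c _ => c.swap) (fun c _ => c.swap) ?_ ?_ ?_ ?_ <;>
    simp [YoungDiagram.mem_transpose]

theorem rowLen_card (μ : YoungDiagram) : μ.rowLen μ.card = 0 := by
  by_contra h
  have h0 : (μ.card, 0) ∈ μ := YoungDiagram.mem_iff_lt_rowLen.2 (Nat.pos_of_ne_zero h)
  have h1 := YoungDiagram.mem_iff_lt_colLen.1 h0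
  have h2 : μ.colLen 0 ≤ μ.card := by
    rw [YoungDiagram.colLen_eq_card]
    exact Finset.card_le_card (Finset.filter_subset _ _)
  omega

theorem rowLen_eq_zero_of_le {μ : YoungDiagram} {M N : ℕ} (hM : μ.rowLen M = 0) (h : M ≤ N) :
    μ.rowLen N = 0 :=
  Nat.le_zero.1 (hM ▸ μ.rowLen_anti M N h)

@[simp]
theorem rowLen_bot (i : ℕ) : (⊥ : YoungDiagram).rowLen i = 0 :=
  rowLen_eq_of_mem_iff fun j => by simp

@[simp]
theorem colLen_bot (i : ℕ) : (⊥ : YoungDiagram).colLen i = 0 :=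
  colLen_eq_of_mem_iff fun j => by simp

@[simp]
theorem card_bot : (⊥ : YoungDiagram).card = 0 := by simp [YoungDiagram.card]

theorem card_eq_zero {μ : YoungDiagram} : μ.card = 0 ↔ μ = ⊥ := by
  refine ⟨fun h => YoungDiagram.ext ?_, fun h => by simp [h]⟩
  simpa [YoungDiagram.card] using h

@[simp]
theorem transpose_bot : (⊥ : YoungDiagram).transpose = ⊥ := by
  rw [← card_eq_zero, card_transpose, card_bot]

theorem rowLen_rowShape (h i : ℕ) : (rowShape h).rowLen i = if i = 0 then h else 0 := by
  apply rowLen_eq_of_mem_iff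
  intro j
  rw [rowShape, YoungDiagram.mem_ofRowLens]
  rcases i with _ | i <;> simp

theorem colLen_colShape (h j : ℕ) : (colShape h).colLen j = if j = 0 then h else 0 := by
  apply colLen_eq_of_mem_iff
  intro i
  rw [colShape, YoungDiagram.mem_ofRowLens]
  rcases j with _ | j <;> simp

theorem transpose_rowShape (h : ℕ) : (rowShape h).transpose = colShape h :=
  ext_colLen fun j => by rw [YoungDiagram.colLen_transpose, rowLen_rowShape, colLen_colShape]

theorem card_rowShape (h : ℕ) : (rowShape h).card = h := by
  rw [card_eq_sum_rowLen (N := 1) _ (by simp [rowLen_rowShape])]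
  simp [rowLen_rowShape]

/-- The partitions of all numbers up to `n`. -/
def partitionsUpTo (n : ℕ) : Finset YoungDiagram := (Finset.range (n + 1)).biUnion partitionsOf

@[simp]
theorem mem_partitionsUpTo {n : ℕ} {μ : YoungDiagram} : μ ∈ partitionsUpTo n ↔ μ.card ≤ n := by
  simp [partitionsUpTo]

/-! ### Horizontal and vertical strips -/

/-- `λ / μ` is a horizontal strip: `λ₁ ≥ μ₁ ≥ λ₂ ≥ μ₂ ≥ ⋯`. -/
def HStrip (μ lam : YoungDiagram) : Prop :=
  ∀ i, μ.rowLen i ≤ lam.rowLen i ∧ lam.rowLen (i + 1) ≤ μ.rowLen i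

/-- `λ / μ` is a vertical strip: `μᵢ ≤ λᵢ ≤ μᵢ + 1` for all `i`. -/
def VStrip (μ lam : YoungDiagram) : Prop :=
  ∀ i, μ.rowLen i ≤ lam.rowLen i ∧ lam.rowLen i ≤ μ.rowLen i + 1

theorem rowLen_le_iff {μ lam : YoungDiagram} {i k : ℕ} :
    μ.rowLen i ≤ lam.rowLen k ↔ ∀ j, (i, j) ∈ μ → (k, j) ∈ lam := by
  simp only [YoungDiagram.mem_iff_lt_rowLen]
  refine ⟨fun h j hj => hj.trans_le h, fun h => ?_⟩
  by_contra hc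
  exact absurd (h (lam.rowLen k) (not_le.1 hc)) (lt_irrefl _)

theorem colLen_le_iff {μ lam : YoungDiagram} {i k : ℕ} :
    μ.colLen i ≤ lam.colLen k ↔ ∀ j, (j, i) ∈ μ → (j, k) ∈ lam := by
  simp only [YoungDiagram.mem_iff_lt_colLen]
  refine ⟨fun h j hj => hj.trans_le h, fun h => ?_⟩
  by_contra hc
  exact absurd (h (lam.colLen k) (not_le.1 hc)) (lt_irrefl _)

theorem hStrip_iff_mem {μ lam : YoungDiagram} : HStrip μ lam ↔
    (∀ i j, (i, j) ∈ μ → (i, j) ∈ lam) ∧ ∀ i j, (i + 1, j) ∈ lam → (i, j) ∈ μ := by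
  simp only [HStrip, rowLen_le_iff, forall_and]

/-- Interlacing of rows says that no column receives two new cells. The reflection of even
partitions and the column bounds for threshold partitions use this form. -/
theorem hStrip_iff_colLen {μ lam : YoungDiagram} : HStrip μ lam ↔
    ∀ j, μ.colLen j ≤ lam.colLen j ∧ lam.colLen j ≤ μ.colLen j + 1 := by
  simp only [hStrip_iff_mem, YoungDiagram.mem_iff_lt_colLen]
  constructor
  · rintro ⟨h1, h2⟩ j
    constructor
    · by_contra hc
      exact absurd (h1 _ j (not_le.1 hc)) (lt_irrefl _)
    · by_contra hc
      exact absurd (h2 (μ.colLen j) j (by omega)) (lt_irrefl _)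
  · refine fun h => ⟨fun i j hi => ?_, fun i j hi => ?_⟩ <;> have := h j <;> omega

theorem hStrip_transpose {μ lam : YoungDiagram} :
    HStrip μ.transpose lam.transpose ↔ VStrip μ lam := by
  simp only [hStrip_iff_colLen, VStrip, YoungDiagram.colLen_transpose]

theorem vStrip_transpose {μ lam : YoungDiagram} :
    VStrip μ.transpose lam.transpose ↔ HStrip μ lam := by
  rw [← hStrip_transpose, YoungDiagram.transpose_transpose, YoungDiagram.transpose_transpose]

theorem vStrip_iff_mem {μ lam : YoungDiagram} : VStrip μ lam ↔
    (∀ i j, (i, j) ∈ μ → (i, j) ∈ lam) ∧ ∀ i j, (i, j + 1) ∈ lam → (i, j) ∈ μ := by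
  rw [← hStrip_transpose, hStrip_iff_mem]
  simp only [YoungDiagram.mem_transpose, Prod.swap_prod_mk]
  exact and_congr forall_comm forall_comm

theorem vStrip_iff_colLen {μ lam : YoungDiagram} : VStrip μ lam ↔
    ∀ j, μ.colLen j ≤ lam.colLen j ∧ lam.colLen (j + 1) ≤ μ.colLen j := by
  simp only [vStrip_iff_mem, colLen_le_iff, forall_and]
  exact and_congr forall_comm forall_comm

theorem card_le_of_subset {μ lam : YoungDiagram} (h : ∀ i j, (i, j) ∈ μ → (i, j) ∈ lam) :
    μ.card ≤ lam.card :=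
  Finset.card_le_card fun ⟨i, j⟩ hc =>
    (YoungDiagram.mem_cells _).2 (h i j ((YoungDiagram.mem_cells _).1 hc))

theorem HStrip.card_le {μ lam : YoungDiagram} (h : HStrip μ lam) : μ.card ≤ lam.card :=
  card_le_of_subset (hStrip_iff_mem.1 h).1

theorem VStrip.card_le {μ lam : YoungDiagram} (h : VStrip μ lam) : μ.card ≤ lam.card :=
  card_le_of_subset (vStrip_iff_mem.1 h).1

theorem hStrip_bot {μ : YoungDiagram} : HStrip ⊥ μ ↔ μ = rowShape μ.card := by
  constructor
  · intro h
    have h1 : μ.rowLen 1 = 0 := by simpa using (h 0).2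
    apply ext_rowLen
    intro i
    rw [rowLen_rowShape]
    rcases i with _ | i
    · simp [card_eq_sum_rowLen μ h1]
    · simpa using (h i).2
  · intro h i
    rw [h]
    simp [rowLen_rowShape]

/-! ### The branching rule -/

section Branching

variable {R : Type*} [CommRing R]

/-- The Schur polynomial `s_μ` evaluated at `x 0, …, x (n - 1)`. -/
def schurVal (x : ℕ → R) (n : ℕ) (μ : YoungDiagram) : R :=
  ∑ T : Tableau n μ, ∏ c ∈ μ.cells, x (T.1 c.1 c.2)

@[simp]
theorem schurVal_bot (x : ℕ → R) (n : ℕ) : schurVal x n ⊥ = 1 := by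
  have : Unique (Tableau n ⊥) :=
    { default := ⟨default, fun i j h => absurd h (YoungDiagram.notMem_bot _)⟩
      uniq := fun T => Subtype.ext (by
        ext i j
        rw [T.1.zeros (YoungDiagram.notMem_bot _),
          SemistandardYoungTableau.zeros _ (YoungDiagram.notMem_bot _)]) }
  simp [schurVal]

theorem schurVal_zero (x : ℕ → R) (μ : YoungDiagram) :
    schurVal x 0 μ = if μ = ⊥ then 1 else 0 := by
  split_ifs with h
  · rw [h, schurVal_bot]
  · have : IsEmpty (Tableau 0 μ) := by
      refine ⟨fun T => h ?_⟩
      apply ext_mem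
      intro i j
      simp only [YoungDiagram.notMem_bot, iff_false]
      exact fun hc => absurd (T.2 i j hc) (Nat.not_lt_zero _)
    simp [schurVal]

/-- The cells of a tableau with entries smaller than `n`. -/
def shapeBelow {lam : YoungDiagram} (n : ℕ) (T : SemistandardYoungTableau lam) : YoungDiagram where
  cells := lam.cells.filter fun c => T c.1 c.2 < n
  isLowerSet := by
    rintro ⟨i, j⟩ ⟨i', j'⟩ ⟨hi, hj⟩ h
    simp only [Finset.coe_filter, YoungDiagram.mem_cells, Set.mem_ofPred_eq] at h ⊢
    refine ⟨lam.up_left_mem hi hj h.1, ?_⟩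
    have h1 : T i' j' ≤ T i j' := T.col_weak hi (lam.up_left_mem le_rfl hj h.1)
    have h2 : T i j' ≤ T i j := T.row_weak_of_le hj h.1
    omega

theorem mem_shapeBelow {lam : YoungDiagram} {n : ℕ} {T : SemistandardYoungTableau lam} {i j : ℕ} :
    (i, j) ∈ shapeBelow n T ↔ (i, j) ∈ lam ∧ T i j < n := by
  rw [← YoungDiagram.mem_cells]
  simp [shapeBelow]

theorem hStrip_shapeBelow {lam : YoungDiagram} {n : ℕ} (T : Tableau (n + 1) lam) :
    HStrip (shapeBelow n T.1) lam := by
  refine hStrip_iff_mem.2 ⟨fun i j h => (mem_shapeBelow.1 h).1, fun i j h => ?_⟩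
  refine mem_shapeBelow.2 ⟨lam.up_left_mem (Nat.le_succ i) le_rfl h, ?_⟩
  have h1 := T.1.col_strict (Nat.lt_succ_self i) h
  have h2 := T.2 _ _ h
  simp only [Nat.succ_eq_add_one] at h1
  omega

/-- Forget the cells outside `μ`. -/
def restrictTableau {μ lam : YoungDiagram} {n : ℕ} (h : ∀ i j, (i, j) ∈ μ → (i, j) ∈ lam)
    (T : SemistandardYoungTableau lam) (hT : ∀ i j, (i, j) ∈ μ → T i j < n) : Tableau n μ :=
  ⟨{ entry := fun i j => if (i, j) ∈ μ then T i j else 0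
     row_weak' := by
       intro i j1 j2 hj hc
       rw [if_pos hc, if_pos (μ.up_left_mem le_rfl hj.le hc)]
       exact T.row_weak hj (h _ _ hc)
     col_strict' := by
       intro i1 i2 j hi hc
       rw [if_pos hc, if_pos (μ.up_left_mem hi.le le_rfl hc)]
       exact T.col_strict hi (h _ _ hc)
     zeros' := fun hc => if_neg hc },
   fun i j hc => (if_pos hc).trans_lt (hT i j hc)⟩

/-- Fill the cells outside `μ` with the entry `n`. -/
def extendTableau {μ lam : YoungDiagram} {n : ℕ} (h : HStrip μ lam) (T : Tableau n μ) :
    Tableau (n + 1) lam :=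
  ⟨{ entry := fun i j => if (i, j) ∈ μ then T.1 i j else if (i, j) ∈ lam then n else 0
     row_weak' := by
       intro i j1 j2 hj hc
       by_cases h2 : (i, j2) ∈ μ
       · rw [if_pos h2, if_pos (μ.up_left_mem le_rfl hj.le h2)]
         exact T.1.row_weak hj h2
       · rw [if_neg h2, if_pos hc]
         by_cases h1 : (i, j1) ∈ μ
         · rw [if_pos h1]
           exact (T.2 _ _ h1).le
         · rw [if_neg h1]
           split_ifs <;> omega
     col_strict' := by
       intro i1 i2 j hi hc
       -- A horizontal strip has no two cells in one column, so a cell of `lam` with another one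
       -- below it already belongs to `μ`.
       have h1 : (i1, j) ∈ μ :=
         (hStrip_iff_mem.1 h).2 _ _ (lam.up_left_mem (Nat.succ_le_of_lt hi) le_rfl hc)
       rw [if_pos h1]
       by_cases h2 : (i2, j) ∈ μ
       · rw [if_pos h2]
         exact T.1.col_strict hi h2
       · rw [if_neg h2, if_pos hc]
         exact T.2 _ _ h1
     zeros' := by
       intro i j hc
       rw [if_neg fun hm => hc ((hStrip_iff_mem.1 h).1 _ _ hm), if_neg hc] },
   by
    intro i j hc
    change (if (i, j) ∈ μ then T.1 i j else if (i, j) ∈ lam then n else 0) < n + 1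
    by_cases h1 : (i, j) ∈ μ
    · rw [if_pos h1]
      exact (T.2 _ _ h1).trans (Nat.lt_succ_self n)
    · rw [if_neg h1, if_pos hc]
      exact Nat.lt_succ_self n⟩

theorem restrictTableau_apply {μ lam : YoungDiagram} {n : ℕ}
    (h : ∀ i j, (i, j) ∈ μ → (i, j) ∈ lam)
    (T : SemistandardYoungTableau lam) (hT : ∀ i j, (i, j) ∈ μ → T i j < n) (i j : ℕ) :
    (restrictTableau h T hT).1 i j = if (i, j) ∈ μ then T i j else 0 := rfl

theorem extendTableau_apply {μ lam : YoungDiagram} {n : ℕ} (h : HStrip μ lam) (T : Tableau n μ)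
    (i j : ℕ) : (extendTableau h T).1 i j =
      if (i, j) ∈ μ then T.1 i j else if (i, j) ∈ lam then n else 0 := rfl

theorem shapeBelow_extendTableau {μ lam : YoungDiagram} {n : ℕ} (h : HStrip μ lam)
    (T : Tableau n μ) : shapeBelow n (extendTableau h T).1 = μ := by
  apply ext_mem
  intro i j
  rw [mem_shapeBelow, extendTableau_apply]
  by_cases h1 : (i, j) ∈ μ
  · rw [if_pos h1]
    exact ⟨fun _ => h1, fun _ => ⟨(hStrip_iff_mem.1 h).1 _ _ h1, T.2 _ _ h1⟩⟩
  · rw [if_neg h1]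
    refine ⟨fun h2 => ?_, fun h2 => absurd h2 h1⟩
    rw [if_pos h2.1] at h2
    exact absurd h2.2 (lt_irrefl n)

/-- Columns increase strictly, so the largest entry `n` occurs at most once in each column, at its
bottom. Deleting these cells leaves a tableau whose shape differs from `lam` by a horizontal strip.
-/
theorem schurVal_succ (x : ℕ → R) (n : ℕ) (lam : YoungDiagram) :
    schurVal x (n + 1) lam = ∑ μ ∈ partitionsUpTo lam.card with HStrip μ lam,
      x n ^ (lam.card - μ.card) * schurVal x n μ := by
  have hmaps : ∀ T ∈ (Finset.univ : Finset (Tableau (n + 1) lam)), shapeBelow n T.1 ∈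
      (partitionsUpTo lam.card).filter fun μ => HStrip μ lam := by
    intro T _
    rw [Finset.mem_filter, mem_partitionsUpTo]
    exact ⟨(hStrip_shapeBelow T).card_le, hStrip_shapeBelow T⟩
  rw [schurVal, ← Finset.sum_fiberwise_of_maps_to hmaps]
  refine Finset.sum_congr rfl fun μ hμ => ?_
  have hs : HStrip μ lam := (Finset.mem_filter.1 hμ).2
  have hsub := (hStrip_iff_mem.1 hs).1
  rw [schurVal, Finset.mul_sum]
  have key : ∀ T : Tableau (n + 1) lam, shapeBelow n T.1 = μ → ∀ i j, (i, j) ∈ μ → T.1 i j < n := by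
    rintro T rfl i j h
    exact (mem_shapeBelow.1 h).2
  refine Finset.sum_bij' (fun T hT => restrictTableau hsub T.1 (key T (Finset.mem_filter.1 hT).2))
    (fun T _ => extendTableau hs T) ?_ ?_ ?_ ?_ ?_
  · intro T hT
    exact Finset.mem_univ _
  · intro T _
    exact Finset.mem_filter.2 ⟨Finset.mem_univ _, shapeBelow_extendTableau hs T⟩
  · intro T hT
    have hT := (Finset.mem_filter.1 hT).2
    apply Subtype.ext
    ext i j
    rw [extendTableau_apply, restrictTableau_apply]
    by_cases h1 : (i, j) ∈ μ
    · simp [h1]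
    · by_cases h2 : (i, j) ∈ lam
      · rw [if_neg h1, if_pos h2]
        rw [← hT, mem_shapeBelow] at h1
        have := T.2 _ _ h2
        have : ¬ T.1 i j < n := fun h => h1 ⟨h2, h⟩
        omega
      · rw [if_neg h1, if_neg h2, T.1.zeros h2]
  · intro T _
    apply Subtype.ext
    ext i j
    rw [restrictTableau_apply, extendTableau_apply]
    by_cases h1 : (i, j) ∈ μ
    · simp [h1]
    · rw [if_neg h1, T.1.zeros h1]
  · intro T hT
    have hT := (Finset.mem_filter.1 hT).2
    have hcells : μ.cells ⊆ lam.cells := fun ⟨i, j⟩ hc =>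
      (YoungDiagram.mem_cells _).2 (hsub i j ((YoungDiagram.mem_cells _).1 hc))
    rw [← Finset.prod_sdiff hcells]
    congr 1
    · rw [YoungDiagram.card, YoungDiagram.card, ← Finset.card_sdiff_of_subset hcells]
      apply Finset.prod_eq_pow_card
      rintro ⟨i, j⟩ hc
      simp only [Finset.mem_sdiff, YoungDiagram.mem_cells] at hc
      have h1 := T.2 _ _ hc.1
      have h2 : ¬ T.1 i j < n := fun h => hc.2 (hT ▸ mem_shapeBelow.2 ⟨hc.1, h⟩)
      have h3 : T.1 i j = n := by omega
      simp only [h3]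
    · refine Finset.prod_congr rfl ?_
      rintro ⟨i, j⟩ hc
      rw [restrictTableau_apply, if_pos ((YoungDiagram.mem_cells _).1 hc)]

end Branching

/-! ### Complete homogeneous functions in terms of power sums -/

section HSeries

variable {R : Type*} [CommRing R] [Algebra ℚ R]

/-- The complete homogeneous symmetric function `h_k` as a polynomial in the power sums
`p_r = φ r`, defined by Newton's recursion `k h_k = ∑ p_{k-i} h_i`. -/
def hsym (φ : ℕ+ → R) : ℕ → R
  | 0 => 1
  | k + 1 => ((k + 1 : ℚ)⁻¹) • ∑ i : Fin (k + 1), φ (Nat.succPNat (k - i)) * hsym φ i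

@[simp]
theorem hsym_zero (φ : ℕ+ → R) : hsym φ 0 = 1 := by rw [hsym]

theorem natCast_succ_smul (k : ℕ) (a : R) : ((k + 1 : ℚ)) • a = (k + 1 : R) * a := by
  rw [Algebra.smul_def]
  simp

theorem succ_mul_hsym (φ : ℕ+ → R) (k : ℕ) : (k + 1 : R) * hsym φ (k + 1) =
    ∑ i ∈ Finset.range (k + 1), φ (Nat.succPNat (k - i)) * hsym φ i := by
  rw [hsym, ← natCast_succ_smul, smul_smul, mul_inv_cancel₀ (by positivity), one_smul,
    Fin.sum_univ_eq_sum_range (fun i => φ (Nat.succPNat (k - i)) * hsym φ i)]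

/-- Newton's recursion has only one solution, as `k + 1` is invertible. The later formulas for
`hsym` are obtained by checking the recursion. -/
theorem eq_hsym {φ : ℕ+ → R} {g : ℕ → R} (h0 : g 0 = 1)
    (h : ∀ k : ℕ, (k + 1 : R) * g (k + 1) =
      ∑ i ∈ Finset.range (k + 1), φ (Nat.succPNat (k - i)) * g i) (k : ℕ) : g k = hsym φ k := by
  induction k using Nat.strong_induction_on with
  | _ k ih =>
    rcases k with _ | k
    · rw [h0, hsym_zero]
    · have h1 : (k + 1 : R) * g (k + 1) = (k + 1 : R) * hsym φ (k + 1) := by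
        rw [h, succ_mul_hsym]
        refine Finset.sum_congr rfl fun i hi => ?_
        rw [ih i (Finset.mem_range.1 hi)]
      rw [← natCast_succ_smul, ← natCast_succ_smul] at h1
      have h2 := congrArg (fun a => ((k + 1 : ℚ)⁻¹) • a) h1
      simpa only [smul_smul, inv_mul_cancel₀ (show (k + 1 : ℚ) ≠ 0 by positivity), one_smul]
        using h2

theorem map_hsym {S : Type*} [CommRing S] [Algebra ℚ S] (f : R →+* S) (φ : ℕ+ → R) (k : ℕ) :
    f (hsym φ k) = hsym (fun r => f (φ r)) k := by
  refine eq_hsym (g := fun k => f (hsym φ k)) (by simp) (fun k : ℕ => ?_) k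
  have := congrArg f (succ_mul_hsym φ k)
  simpa only [map_mul, map_add, map_natCast, map_one, map_sum] using this

theorem hsym_pow_mul (y : R) (φ : ℕ+ → R) (k : ℕ) :
    hsym (fun r => y ^ (r : ℕ) * φ r) k = y ^ k * hsym φ k := by
  symm
  refine eq_hsym (g := fun k => y ^ k * hsym φ k) (by simp) (fun k : ℕ => ?_) k
  have := succ_mul_hsym φ k
  calc (k + 1 : R) * (y ^ (k + 1) * hsym φ (k + 1))
      = y ^ (k + 1) * ((k + 1 : R) * hsym φ (k + 1)) := by ring
    _ = _ := by
      rw [this, Finset.mul_sum]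
      refine Finset.sum_congr rfl fun i hi => ?_
      have hi := Finset.mem_range.1 hi
      have : k + 1 = (k - i + 1) + i := by omega
      rw [Nat.succPNat_coe, Nat.succ_eq_add_one]
      conv_lhs => rw [this, pow_add]
      ring

theorem hsym_geom (a : R) (k : ℕ) : hsym (fun r => a ^ (r : ℕ)) k = a ^ k := by
  symm
  refine eq_hsym (g := fun k => a ^ k) (by simp) (fun k : ℕ => ?_) k
  -- All `k + 1` summands of the recursion equal `a ^ (k + 1)`.
  rw [Finset.sum_congr rfl (g := fun _ => a ^ (k + 1))]
  · simp
  · intro i hi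
    have hi := Finset.mem_range.1 hi
    rw [Nat.succPNat_coe, Nat.succ_eq_add_one, ← pow_add]
    congr 1
    omega

theorem hsym_zero_left (k : ℕ) : hsym (fun _ => (0 : R)) k = if k = 0 then 1 else 0 := by
  symm
  exact eq_hsym (g := fun k => if k = 0 then 1 else 0) (by simp) (fun k : ℕ => by simp) k

theorem derivative_mk_hsym (φ : ℕ+ → R) :
    PowerSeries.derivative R (PowerSeries.mk (hsym φ)) =
      PowerSeries.mk (fun n => φ (Nat.succPNat n)) * PowerSeries.mk (hsym φ) := by
  ext k
  rw [PowerSeries.coeff_derivative, PowerSeries.coeff_mk, mul_comm, succ_mul_hsym,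
    PowerSeries.coeff_mul,
    Finset.Nat.sum_antidiagonal_eq_sum_range_succ_mk, ← Finset.sum_range_reflect]
  refine Finset.sum_congr rfl fun i hi => ?_
  have hi := Finset.mem_range.1 hi
  have e1 : k + 1 - 1 - i = k - i := by omega
  have e2 : k - (k - i) = i := by omega
  simp only [e1, e2, PowerSeries.coeff_mk]

/-- Newton's recursion says that the generating series `H` satisfies `H' = P H`, with `P` the series
of power sums. For a product of two such series the factors `P` add. -/
theorem hsym_add (φ ψ : ℕ+ → R) (k : ℕ) : hsym (fun r => φ r + ψ r) k =
    ∑ p ∈ Finset.HasAntidiagonal.antidiagonal k, hsym φ p.1 * hsym ψ p.2 := by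
  symm
  have key : ∀ k, ∑ p ∈ Finset.HasAntidiagonal.antidiagonal k, hsym φ p.1 * hsym ψ p.2 =
      PowerSeries.coeff k (PowerSeries.mk (hsym φ) * PowerSeries.mk (hsym ψ)) := by
    intro k
    simp [PowerSeries.coeff_mul]
  refine eq_hsym (g := fun k => ∑ p ∈ Finset.HasAntidiagonal.antidiagonal k, hsym φ p.1 * hsym ψ p.2)
    (by simp) (fun k : ℕ => ?_) k
  simp only [key]
  have h1 : PowerSeries.derivative R (PowerSeries.mk (hsym φ) * PowerSeries.mk (hsym ψ)) =
      PowerSeries.mk (fun n => φ (Nat.succPNat n) + ψ (Nat.succPNat n)) *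
        (PowerSeries.mk (hsym φ) * PowerSeries.mk (hsym ψ)) := by
    have : PowerSeries.mk (fun n => φ (Nat.succPNat n) + ψ (Nat.succPNat n)) =
      PowerSeries.mk (fun n => φ (Nat.succPNat n)) + PowerSeries.mk (fun n => ψ (Nat.succPNat n)) := by
      ext; simp
    rw [Derivation.leibniz, derivative_mk_hsym, derivative_mk_hsym, this, smul_eq_mul, smul_eq_mul]
    ring
  have h2 := congrArg (PowerSeries.coeff k) h1
  rw [PowerSeries.coeff_derivative, PowerSeries.coeff_mul k (PowerSeries.mk _),
    Finset.Nat.sum_antidiagonal_eq_sum_range_succ_mk, ← Finset.sum_range_reflect] at h2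
  rw [mul_comm, h2]
  refine Finset.sum_congr rfl fun i hi => ?_
  have hi := Finset.mem_range.1 hi
  have e1 : k + 1 - 1 - i = k - i := by omega
  have e2 : k - (k - i) = i := by omega
  simp only [e1, e2, PowerSeries.coeff_mk]

theorem sum_hsym_neg (φ : ℕ+ → R) (k : ℕ) :
    ∑ p ∈ Finset.HasAntidiagonal.antidiagonal k, hsym φ p.1 * hsym (fun r => -φ r) p.2 =
      if k = 0 then 1 else 0 := by
  rw [← hsym_add, ← hsym_zero_left]
  simp

/-- The power sums after applying the standard involution: `p_r ↦ (-1)^(r-1) p_r`. -/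
def omegaSeq (φ : ℕ+ → R) : ℕ+ → R := fun r => (-1) ^ ((r : ℕ) + 1) * φ r

theorem hsym_omegaSeq (φ : ℕ+ → R) (k : ℕ) :
    hsym (omegaSeq φ) k = (-1) ^ k * hsym (fun r => -φ r) k := by
  rw [← hsym_pow_mul]
  congr 1
  ext r
  rw [omegaSeq, pow_succ]
  ring

theorem hsym_two (φ : ℕ+ → R) : hsym φ 2 = (2 : ℚ)⁻¹ • (φ 1 ^ 2 + φ 2) := by
  have h1 : hsym φ 1 = φ 1 := by
    rw [hsym]
    simp
    rfl
  have e1 : Nat.succPNat (1 - (0 : Fin 2)) = 2 := rfl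
  have e2 : Nat.succPNat (1 - (1 : Fin 2)) = 1 := rfl
  rw [hsym, Fin.sum_univ_two, e1, e2, Fin.val_zero, Fin.val_one, hsym_zero, h1]
  congr 1
  · norm_num
  · ring

end HSeries

/-! ### Pieri rules -/

/-- The Young diagram with row lengths `f`, provided that `f` is a partition. -/
def mkRows (f : ℕ → ℕ) : YoungDiagram :=
  if h : Antitone f ∧ ∃ N, f N = 0 then ofFun f h.1 h.2.choose h.2.choose_spec else ⊥

theorem rowLen_mkRows {f : ℕ → ℕ} (hf : ∀ i, f (i + 1) ≤ f i) {N : ℕ} (hN : f N = 0) (i : ℕ) :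
    (mkRows f).rowLen i = f i := by
  rw [mkRows, dif_pos ⟨antitone_nat_of_succ_le hf, N, hN⟩, rowLen_ofFun]

theorem card_eq_sum_of_le (μ : YoungDiagram) {N : ℕ} (h : μ.card ≤ N) :
    μ.card = ∑ i ∈ Finset.range N, μ.rowLen i :=
  card_eq_sum_rowLen μ (rowLen_eq_zero_of_le (rowLen_card μ) h)

/-- Summing the hypothesis over all rows, minima and maxima combine to `|ν| + |ρ|`, except that row
`0` is missing among the maxima and in `μ`. -/
theorem card_add_card_of_interlacing {ν ρ κ μ : YoungDiagram}
    (h : ∀ i, κ.rowLen i + μ.rowLen (i + 1) =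
      min (ν.rowLen i) (ρ.rowLen i) + max (ν.rowLen (i + 1)) (ρ.rowLen (i + 1))) :
    κ.card + μ.card + max (ν.rowLen 0) (ρ.rowLen 0) = ν.card + ρ.card + μ.rowLen 0 := by
  obtain ⟨N, h1, h2, h3, h4⟩ : ∃ N, ν.card ≤ N ∧ ρ.card ≤ N ∧ κ.card ≤ N ∧ μ.card ≤ N :=
    ⟨ν.card + ρ.card + κ.card + μ.card, by omega, by omega, by omega, by omega⟩
  have z1 : ν.rowLen N = 0 := rowLen_eq_zero_of_le (rowLen_card ν) h1
  have z2 : ρ.rowLen N = 0 := rowLen_eq_zero_of_le (rowLen_card ρ) h2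
  have s1 := Finset.sum_congr (rfl : Finset.range N = Finset.range N) fun i _ => h i
  rw [Finset.sum_add_distrib, Finset.sum_add_distrib, ← card_eq_sum_of_le κ h3] at s1
  have s2 : μ.card = ∑ i ∈ Finset.range N, μ.rowLen (i + 1) + μ.rowLen 0 := by
    rw [card_eq_sum_of_le μ (h4.trans (Nat.le_succ N)), Finset.sum_range_succ']
  have s3 : ∑ i ∈ Finset.range N, max (ν.rowLen (i + 1)) (ρ.rowLen (i + 1)) +
      max (ν.rowLen 0) (ρ.rowLen 0) = ∑ i ∈ Finset.range N, max (ν.rowLen i) (ρ.rowLen i) := by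
    rw [← Finset.sum_range_succ' (fun i => max (ν.rowLen i) (ρ.rowLen i)), Finset.sum_range_succ]
    simp [z1, z2]
  have s4 : ∑ i ∈ Finset.range N, min (ν.rowLen i) (ρ.rowLen i) +
      ∑ i ∈ Finset.range N, max (ν.rowLen i) (ρ.rowLen i) = ν.card + ρ.card := by
    rw [card_eq_sum_of_le ν h1, card_eq_sum_of_le ρ h2, ← Finset.sum_add_distrib,
      ← Finset.sum_add_distrib]
    exact Finset.sum_congr rfl fun i _ => min_add_max _ _
  omega

/-- Row `i` of `κ` and row `i + 1` of `μ` are confined to the same interval, from `max (ν_{i+1})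
(ρ_{i+1})` to `min ν_i ρ_i`. Reflecting this interval, whose endpoints add up to `m i`, is the
bijection. -/
theorem card_common_hStrip (ν ρ : YoungDiagram) (k : ℕ) :
    ((partitionsUpTo ν.card).filter fun κ =>
      HStrip κ ν ∧ HStrip κ ρ ∧ ρ.card ≤ κ.card + k).card =
    ((partitionsOf (ν.card + k)).filter fun μ => HStrip ν μ ∧ HStrip ρ μ).card := by
  let m : ℕ → ℕ := fun i =>
    min (ν.rowLen i) (ρ.rowLen i) + max (ν.rowLen (i + 1)) (ρ.rowLen (i + 1))
  -- Row `0` of `μ` is bounded only from below; its excess is dictated by the prescribed size, and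
  -- `ρ.card ≤ κ.card + k` makes it a genuine difference.
  let F : YoungDiagram → ℕ → ℕ := fun κ i =>
    Nat.casesOn i (max (ν.rowLen 0) (ρ.rowLen 0) + (κ.card + k - ρ.card))
      fun i => m i - κ.rowLen i
  have hF0 : ∀ κ, F κ 0 = max (ν.rowLen 0) (ρ.rowLen 0) + (κ.card + k - ρ.card) := fun _ => rfl
  have hFs : ∀ κ i, F κ (i + 1) = m i - κ.rowLen i := fun _ _ => rfl
  let G : YoungDiagram → ℕ → ℕ := fun μ i => m i - μ.rowLen (i + 1)
  have z1 := rowLen_card ν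
  have z2 := rowLen_card ρ
  have z3 : ν.rowLen (ν.card + ρ.card) = 0 := rowLen_eq_zero_of_le z1 (by omega)
  have z4 : ρ.rowLen (ν.card + ρ.card) = 0 := rowLen_eq_zero_of_le z2 (by omega)
  have z5 : ν.rowLen (ν.card + ρ.card + 1) = 0 := rowLen_eq_zero_of_le z1 (by omega)
  have z6 : ρ.rowLen (ν.card + ρ.card + 1) = 0 := rowLen_eq_zero_of_le z2 (by omega)
  have hF : ∀ κ, HStrip κ ν → HStrip κ ρ → ∀ i, (mkRows (F κ)).rowLen i = F κ i := by
    intro κ h1 h2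
    apply rowLen_mkRows (N := ν.card + ρ.card + 1)
    · rintro (_ | i)
      · have := h1 0
        have := h2 0
        simp only [hF0, hFs, m]
        omega
      · have := h1 i
        have := h2 i
        have := h1 (i + 1)
        have := h2 (i + 1)
        simp only [hFs, m]
        omega
    · simp only [hFs, m]
      omega
  have hG : ∀ μ, HStrip ν μ → HStrip ρ μ → ∀ i, (mkRows (G μ)).rowLen i = G μ i := by
    intro μ h1 h2
    apply rowLen_mkRows (N := ν.card + ρ.card)
    · intro i
      have := h1 i
      have := h2 i
      have := h1 (i + 1)
      have := h2 (i + 1)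
      have := h1 (i + 1 + 1)
      have := h2 (i + 1 + 1)
      simp only [G, m]
      omega
    · simp only [G, m]
      omega
  refine Finset.card_bij' (fun κ _ => mkRows (F κ)) (fun μ _ => mkRows (G μ)) ?_ ?_ ?_ ?_
  · intro κ hκ
    simp only [Finset.mem_filter, mem_partitionsUpTo] at hκ
    obtain ⟨h0, h1, h2, h3⟩ := hκ
    have hr := hF κ h1 h2
    have hc := card_add_card_of_interlacing (ν := ν) (ρ := ρ) (κ := κ) (μ := mkRows (F κ)) (by
      intro i
      have := h1 i
      have := h2 i
      rw [hr]
      simp only [hFs, m]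
      omega)
    rw [hr] at hc
    simp only [hF0] at hc
    simp only [Finset.mem_filter, mem_partitionsOf]
    refine ⟨by omega, fun i => ?_, fun i => ?_⟩
    all_goals
      rw [hr, hr]
      have := h1 i
      have := h2 i
      rcases i with _ | i
      · simp only [hF0, hFs, m]
        omega
      · have := h1 (i + 1)
        have := h2 (i + 1)
        have := h1 i
        have := h2 i
        simp only [hFs, m]
        omega
  · intro μ hμ
    simp only [Finset.mem_filter, mem_partitionsOf] at hμ
    obtain ⟨h0, h1, h2⟩ := hμ
    have hr := hG μ h1 h2
    have hc := card_add_card_of_interlacing (ν := ν) (ρ := ρ) (κ := mkRows (G μ)) (μ := μ) (by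
      intro i
      have := h1 i
      have := h2 i
      rw [hr]
      simp only [G, m]
      omega)
    have hs : HStrip (mkRows (G μ)) ν := by
      intro i
      have := h1 i
      have := h2 i
      have := h1 (i + 1)
      have := h2 (i + 1)
      rw [hr]
      simp only [G, m]
      omega
    have := h1 0
    have := h2 0
    simp only [Finset.mem_filter, mem_partitionsUpTo]
    refine ⟨hs.card_le, hs, fun i => ?_, by omega⟩
    have := h1 i
    have := h2 i
    have := h1 (i + 1)
    have := h2 (i + 1)
    rw [hr]
    simp only [G, m]
    omega
  · intro κ hκ
    simp only [Finset.mem_filter, mem_partitionsUpTo] at hκ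
    obtain ⟨h0, h1, h2, h3⟩ := hκ
    have hr := hF κ h1 h2
    have e : G (mkRows (F κ)) = κ.rowLen := by
      funext i
      have := h1 i
      have := h2 i
      simp only [G, hr]
      simp only [hFs, m]
      omega
    rw [e]
    exact ext_rowLen (rowLen_mkRows (fun i => κ.rowLen_anti _ _ (Nat.le_succ i)) (rowLen_card κ))
  · intro μ hμ
    simp only [Finset.mem_filter, mem_partitionsOf] at hμ
    obtain ⟨h0, h1, h2⟩ := hμ
    have hr := hG μ h1 h2
    have hc := card_add_card_of_interlacing (ν := ν) (ρ := ρ) (κ := mkRows (G μ)) (μ := μ) (by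
      intro i
      have := h1 i
      have := h2 i
      rw [hr]
      simp only [G, m]
      omega)
    have e : F (mkRows (G μ)) = μ.rowLen := by
      funext i
      rcases i with _ | i
      -- The interlacing relation does not see row `0`; it is recovered from the size identity `hc`.
      · have := h1 0
        have := h2 0
        simp only [hF0]
        omega
      · have := h1 i
        have := h2 i
        simp only [F, hr]
        simp only [G, m]
        omega
    rw [e]
    exact ext_rowLen (rowLen_mkRows (fun i => μ.rowLen_anti _ _ (Nat.le_succ i)) (rowLen_card μ))

theorem sum_antidiagonal_partitionsOf {M : Type*} [AddCommMonoid M] (a k : ℕ)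
    (A : YoungDiagram → Prop) (hA : ∀ ρ, A ρ → a ≤ ρ.card) (g : YoungDiagram → ℕ → M) :
    ∑ p ∈ Finset.HasAntidiagonal.antidiagonal k, ∑ ρ ∈ partitionsOf (a + p.1) with A ρ, g ρ p.2 =
      ∑ ρ ∈ partitionsUpTo (a + k) with A ρ, g ρ (a + k - ρ.card) := by
  have hmaps : ∀ ρ ∈ (partitionsUpTo (a + k)).filter A,
      (ρ.card - a, a + k - ρ.card) ∈ Finset.HasAntidiagonal.antidiagonal k := by
    intro ρ hρ
    simp only [Finset.mem_filter, mem_partitionsUpTo] at hρ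
    have := hA ρ hρ.2
    rw [Finset.HasAntidiagonal.mem_antidiagonal]
    dsimp only
    omega
  rw [← Finset.sum_fiberwise_of_maps_to hmaps]
  refine Finset.sum_congr rfl ?_
  rintro ⟨b, c⟩ hp
  have hp : b + c = k := Finset.HasAntidiagonal.mem_antidiagonal.1 hp
  refine Finset.sum_congr ?_ ?_
  · ext ρ
    simp only [Finset.mem_filter, mem_partitionsUpTo, mem_partitionsOf, Prod.mk.injEq]
    constructor
    · rintro ⟨h1, h2⟩
      exact ⟨⟨by omega, h2⟩, by omega, by omega⟩
    · rintro ⟨⟨h1, h2⟩, h3, h4⟩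
      have := hA ρ h2
      exact ⟨by omega, h2⟩
  · intro ρ hρ
    simp only [Finset.mem_filter, Prod.mk.injEq] at hρ
    rw [hρ.2.2]

section Pieri

variable {R : Type*} [CommRing R] [Algebra ℚ R]

/-- The power sums of `x 0, …, x (n - 1)`. -/
def powSums (x : ℕ → R) (n : ℕ) (r : ℕ+) : R := ∑ i ∈ Finset.range n, x i ^ (r : ℕ)

theorem hsym_powSums_succ (x : ℕ → R) (n k : ℕ) : hsym (powSums x (n + 1)) k =
    ∑ p ∈ Finset.HasAntidiagonal.antidiagonal k, hsym (powSums x n) p.1 * x n ^ p.2 := by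
  have : powSums x (n + 1) = fun r => powSums x n r + x n ^ (r : ℕ) := by
    ext r
    rw [powSums, Finset.sum_range_succ, powSums]
  rw [this, hsym_add]
  simp only [hsym_geom]

/-- Pieri's rule. -/
theorem hsym_mul_schurVal (x : ℕ → R) (n k : ℕ) (ν : YoungDiagram) :
    hsym (powSums x n) k * schurVal x n ν =
      ∑ μ ∈ partitionsOf (ν.card + k) with HStrip ν μ, schurVal x n μ := by
  induction n generalizing k ν with
  | zero =>
    have h0 : powSums x 0 = fun _ => 0 := by
      ext r
      simp [powSums]
    rw [h0, hsym_zero_left]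
    simp only [schurVal_zero]
    rw [Finset.sum_ite_eq']
    simp only [Finset.mem_filter, mem_partitionsOf, card_bot]
    by_cases hk : k = 0
    · by_cases hν : ν = ⊥
      · subst hk hν
        simp [HStrip]
      · have : ν.card ≠ 0 := fun h => hν (card_eq_zero.1 h)
        rw [if_neg hν, mul_zero, if_neg (by omega)]
    · rw [if_neg hk, zero_mul, if_neg (by omega)]
  | succ n ih =>
    -- Both sides become combinations of `x n ^ (ν.card + k - ρ.card) * schurVal x n ρ`. The left
    -- coefficient counts the common lower neighbours `κ` of `ν` and `ρ`, the right one their common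
    -- upper neighbours `μ`.
    rw [hsym_powSums_succ, schurVal_succ, Finset.mul_sum]
    have hL : ∀ κ ∈ (partitionsUpTo ν.card).filter (fun κ => HStrip κ ν),
        (∑ p ∈ Finset.HasAntidiagonal.antidiagonal k, hsym (powSums x n) p.1 * x n ^ p.2) *
          (x n ^ (ν.card - κ.card) * schurVal x n κ) =
        ∑ ρ ∈ partitionsUpTo (ν.card + k), if HStrip κ ρ ∧ ρ.card ≤ κ.card + k then
          x n ^ (ν.card + k - ρ.card) * schurVal x n ρ else 0 := by
      intro κ hκ
      simp only [Finset.mem_filter, mem_partitionsUpTo] at hκ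
      rw [← Finset.sum_filter]
      have hset : ((partitionsUpTo (ν.card + k)).filter
          fun ρ => HStrip κ ρ ∧ ρ.card ≤ κ.card + k) =
          (partitionsUpTo (κ.card + k)).filter fun ρ => HStrip κ ρ := by
        ext ρ
        simp only [Finset.mem_filter, mem_partitionsUpTo]
        constructor
        · rintro ⟨h1, h2, h3⟩
          exact ⟨h3, h2⟩
        · rintro ⟨h1, h2⟩
          exact ⟨by omega, h2, h1⟩
      have h1 := sum_antidiagonal_partitionsOf κ.card k (HStrip κ) (fun ρ h => h.card_le)
        (fun ρ c => x n ^ (ν.card - κ.card + c) * schurVal x n ρ)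
      rw [hset, Finset.sum_congr rfl (g := fun ρ => x n ^ (ν.card - κ.card +
        (κ.card + k - ρ.card)) * schurVal x n ρ), ← h1, Finset.sum_mul]
      · refine Finset.sum_congr rfl fun p _ => ?_
        rw [← Finset.mul_sum, ← ih]
        ring
      · intro ρ hρ
        simp only [Finset.mem_filter, mem_partitionsUpTo] at hρ
        congr 2
        omega
    have hR : ∀ μ ∈ (partitionsOf (ν.card + k)).filter (fun μ => HStrip ν μ),
        schurVal x (n + 1) μ = ∑ ρ ∈ partitionsUpTo (ν.card + k), if HStrip ρ μ then
          x n ^ (ν.card + k - ρ.card) * schurVal x n ρ else 0 := by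
      intro μ hμ
      simp only [Finset.mem_filter, mem_partitionsOf] at hμ
      rw [schurVal_succ, ← Finset.sum_filter, hμ.1]
    rw [Finset.sum_congr rfl hL, Finset.sum_congr rfl hR, Finset.sum_comm, Finset.sum_comm
      (s := (partitionsOf (ν.card + k)).filter (fun μ => HStrip ν μ))]
    refine Finset.sum_congr rfl fun ρ _ => ?_
    rw [← Finset.sum_filter, ← Finset.sum_filter, Finset.sum_const, Finset.sum_const,
      Finset.filter_filter, Finset.filter_filter, card_common_hStrip]

/-- For `ν ≠ μ` a sign-reversing involution cancels all terms: in the last row where `ν` and `μ`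
differ, `κ` toggles between the two lengths that the vertical strip permits. -/
theorem sum_neg_one_pow_card {S : Type*} [CommRing S] {ν μ : YoungDiagram} {M : ℕ} (hM : μ.card ≤ M) :
    ∑ κ ∈ partitionsUpTo M with VStrip ν κ ∧ HStrip κ μ, (-1 : S) ^ κ.card =
      if ν = μ then (-1) ^ ν.card else 0 := by
  split_ifs with h
  · subst h
    rw [Finset.sum_eq_single_of_mem ν]
    · simp only [Finset.mem_filter, mem_partitionsUpTo]
      exact ⟨hM, fun i => ⟨le_rfl, Nat.le_succ _⟩, fun i => ⟨le_rfl, ν.rowLen_anti _ _ (Nat.le_succ i)⟩⟩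
    · intro κ hκ hne
      refine absurd (ext_rowLen fun i => ?_) hne
      have h1 := (Finset.mem_filter.1 hκ).2.1 i
      have h2 := (Finset.mem_filter.1 hκ).2.2 i
      omega
  · obtain ⟨p, hp, hmax⟩ : ∃ p, ν.rowLen p ≠ μ.rowLen p ∧
        ∀ i, p < i → ν.rowLen i = μ.rowLen i := by
      have hex : ∃ p, ν.rowLen p ≠ μ.rowLen p := by
        by_contra hc
        push Not at hc
        exact h (ext_rowLen hc)
      obtain ⟨q, hq⟩ := hex
      have hbd : ∀ i, ν.rowLen i ≠ μ.rowLen i → i ≤ ν.card + μ.card := by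
        intro i hi
        by_contra hc
        apply hi
        rw [rowLen_eq_zero_of_le (rowLen_card ν) (by omega),
          rowLen_eq_zero_of_le (rowLen_card μ) (by omega)]
      refine ⟨Nat.findGreatest (fun i => ν.rowLen i ≠ μ.rowLen i) (ν.card + μ.card),
        Nat.findGreatest_spec (P := fun i => ν.rowLen i ≠ μ.rowLen i) (hbd q hq) hq, ?_⟩
      intro i hi
      by_contra hc
      exact Nat.findGreatest_is_greatest hi (hbd i hc) hc
    -- This exchanges `ν_p` and `ν_p + 1`. Both fit: the existence of some `κ` forces `ν_p < μ_p`,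
    -- and `μ_{p+1} = ν_{p+1} ≤ ν_p` by the choice of `p`.
    let t : YoungDiagram → ℕ → ℕ := fun κ =>
      Function.update κ.rowLen p (2 * ν.rowLen p + 1 - κ.rowLen p)
    have ht : ∀ κ, VStrip ν κ → HStrip κ μ →
        (∀ i, (mkRows (t κ)).rowLen i = t κ i) ∧ VStrip ν (mkRows (t κ)) ∧
          HStrip (mkRows (t κ)) μ := by
      intro κ h1 h2
      have hb : ∀ i, ν.rowLen i ≤ t κ i ∧ t κ i ≤ ν.rowLen i + 1 ∧ t κ i ≤ μ.rowLen i ∧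
          μ.rowLen (i + 1) ≤ t κ i := by
        intro i
        have a1 := h1 i
        have a2 := h2 i
        by_cases hi : i = p
        · subst hi
          have := hmax (i + 1) (Nat.lt_succ_self i)
          have := ν.rowLen_anti i (i + 1) (Nat.le_succ i)
          simp only [t, Function.update_self]
          omega
        · simp only [t, Function.update_of_ne hi]
          omega
      have hr : ∀ i, (mkRows (t κ)).rowLen i = t κ i := by
        apply rowLen_mkRows (N := μ.card)
        · intro i
          have := hb i
          have := hb (i + 1)
          omega
        · have := hb μ.card
          have := rowLen_card μ
          omega
      refine ⟨hr, fun i => ?_, fun i => ?_⟩ <;> rw [hr] <;> have := hb i <;> omega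
    have hodd : ∀ κ, VStrip ν κ → HStrip κ μ → Odd (κ.card + (mkRows (t κ)).card) := by
      intro κ h1 h2
      obtain ⟨N, n1, n2, n3⟩ : ∃ N, κ.card ≤ N ∧ (mkRows (t κ)).card ≤ N ∧ p < N :=
        ⟨κ.card + (mkRows (t κ)).card + p + 1, by omega, by omega, by omega⟩
      rw [card_eq_sum_of_le κ n1, card_eq_sum_of_le _ n2,
        Finset.sum_congr rfl fun i _ => (ht κ h1 h2).1 i,
        Finset.sum_update_of_mem (Finset.mem_range.2 n3),
        Finset.sum_eq_add_sum_sdiff_singleton_of_mem (Finset.mem_range.2 n3) κ.rowLen]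
      have := h1 p
      refine ⟨ν.rowLen p + ∑ i ∈ Finset.range N \ {p}, κ.rowLen i, ?_⟩
      omega
    refine Finset.sum_involution (fun κ _ => mkRows (t κ)) ?_ ?_ ?_ ?_
    · intro κ hκ
      have h1 := (Finset.mem_filter.1 hκ).2
      have h2 := hodd κ h1.1 h1.2
      rcases Nat.even_or_odd κ.card with he | ho
      · have : Odd (mkRows (t κ)).card := by
          rcases Nat.even_or_odd (mkRows (t κ)).card with h | h
          · exact absurd (he.add h) (Nat.not_even_iff_odd.2 h2)
          · exact h
        rw [he.neg_one_pow, this.neg_one_pow, add_neg_cancel]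
      · have : Even (mkRows (t κ)).card := by
          rcases Nat.even_or_odd (mkRows (t κ)).card with h | h
          · exact h
          · exact absurd (ho.add_odd h) (Nat.not_even_iff_odd.2 h2)
        rw [ho.neg_one_pow, this.neg_one_pow, neg_add_cancel]
    · intro κ hκ _ he
      have h1 := (Finset.mem_filter.1 hκ).2
      have h2 := hodd κ h1.1 h1.2
      rw [he] at h2
      exact absurd ⟨κ.card, rfl⟩ (Nat.not_even_iff_odd.2 h2)
    · intro κ hκ
      have h1 := (Finset.mem_filter.1 hκ).2
      have h2 := ht κ h1.1 h1.2
      simp only [Finset.mem_filter, mem_partitionsUpTo]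
      exact ⟨h2.2.2.card_le.trans hM, h2.2⟩
    · intro κ hκ
      have h1 := (Finset.mem_filter.1 hκ).2
      have h2 := ht κ h1.1 h1.2
      have h3 := ht _ h2.2.1 h2.2.2
      apply ext_rowLen
      intro i
      rw [h3.1]
      by_cases hi : i = p
      · subst hi
        have := h1.1 i
        simp only [t, Function.update_self] at h2 ⊢
        rw [h2.1, Function.update_self]
        omega
      · simp only [t, Function.update_of_ne hi] at h2 ⊢
        rw [h2.1, Function.update_of_ne hi]

/-- The dual Pieri rule. -/
theorem hsym_neg_mul_schurVal (x : ℕ → R) (n k : ℕ) (ν : YoungDiagram) :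
    hsym (fun r => -powSums x n r) k * schurVal x n ν =
      (-1) ^ k * ∑ μ ∈ partitionsOf (ν.card + k) with VStrip ν μ, schurVal x n μ := by
  -- The series of right-hand sides is shown to be `s_ν` divided by the series of complete
  -- functions: Pieri's rule expands the product, and the sign-reversing involution reduces it to a
  -- constant.
  let V : ℕ → R := fun k =>
    (-1) ^ k * ∑ μ ∈ partitionsOf (ν.card + k) with VStrip ν μ, schurVal x n μ
  have h1 : PowerSeries.mk (hsym (powSums x n)) * PowerSeries.mk V =
      PowerSeries.C (schurVal x n ν) := by
    ext m
    rw [PowerSeries.coeff_C, mul_comm, PowerSeries.coeff_mul]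
    simp only [PowerSeries.coeff_mk, V]
    have e1 : ∀ p ∈ Finset.HasAntidiagonal.antidiagonal m,
        ((-1) ^ p.1 * ∑ μ ∈ partitionsOf (ν.card + p.1) with VStrip ν μ, schurVal x n μ) *
          hsym (powSums x n) p.2 = ∑ κ ∈ partitionsOf (ν.card + p.1) with VStrip ν κ,
            (-1) ^ (κ.card + ν.card) *
              ∑ μ ∈ partitionsOf (ν.card + m) with HStrip κ μ, schurVal x n μ := by
      intro p hp
      have hp := Finset.HasAntidiagonal.mem_antidiagonal.1 hp
      rw [mul_assoc, Finset.sum_mul, Finset.mul_sum]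
      refine Finset.sum_congr rfl fun κ hκ => ?_
      have hκ := mem_partitionsOf.1 (Finset.mem_filter.1 hκ).1
      rw [mul_comm (schurVal x n κ), hsym_mul_schurVal, hκ, add_assoc, hp]
      congr 1
      rw [show ν.card + p.1 + ν.card = p.1 + 2 * ν.card by ring, pow_add, pow_mul]
      simp
    have e2 := sum_antidiagonal_partitionsOf ν.card m (VStrip ν) (fun ρ h => h.card_le)
      (fun κ _ => (-1) ^ (κ.card + ν.card) *
              ∑ μ ∈ partitionsOf (ν.card + m) with HStrip κ μ, schurVal x n μ)
    rw [Finset.sum_congr rfl e1, e2]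
    have e3 : ∀ κ : YoungDiagram, (-1) ^ (κ.card + ν.card) *
        ∑ μ ∈ partitionsOf (ν.card + m) with HStrip κ μ, schurVal x n μ =
        ∑ μ ∈ partitionsOf (ν.card + m),
          if HStrip κ μ then (-1) ^ ν.card * schurVal x n μ * (-1) ^ κ.card else 0 := by
      intro κ
      rw [← Finset.sum_filter, Finset.mul_sum]
      refine Finset.sum_congr rfl fun μ _ => ?_
      ring
    rw [Finset.sum_congr rfl fun κ _ => e3 κ, Finset.sum_comm]
    have e4 : ∀ μ ∈ partitionsOf (ν.card + m),
        (∑ κ ∈ partitionsUpTo (ν.card + m) with VStrip ν κ,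
          if HStrip κ μ then (-1) ^ ν.card * schurVal x n μ * (-1) ^ κ.card else 0) =
        if ν = μ then schurVal x n μ else 0 := by
      intro μ hμ
      rw [← Finset.sum_filter, Finset.filter_filter, ← Finset.mul_sum,
        sum_neg_one_pow_card (mem_partitionsOf.1 hμ).le]
      split_ifs with h
      · rw [mul_right_comm, ← pow_add, Even.neg_one_pow ⟨_, rfl⟩, one_mul]
      · rw [mul_zero]
    rw [Finset.sum_congr rfl e4, Finset.sum_ite_eq]
    simp
  have h2 : PowerSeries.mk (hsym (powSums x n)) *
      PowerSeries.mk (hsym fun r => -powSums x n r) = 1 := by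
    ext m
    rw [PowerSeries.coeff_mul, PowerSeries.coeff_one, ← sum_hsym_neg (powSums x n) m]
    simp
  have h3 : PowerSeries.mk V =
      PowerSeries.mk (hsym fun r => -powSums x n r) * PowerSeries.C (schurVal x n ν) := by
    rw [← h1, ← mul_assoc, mul_comm (PowerSeries.mk (hsym fun r => -powSums x n r)), h2, one_mul]
  have h4 := congrArg (PowerSeries.coeff k) h3
  rw [PowerSeries.coeff_mul_C, PowerSeries.coeff_mk, PowerSeries.coeff_mk] at h4
  exact h4.symm

theorem hsym_omegaSeq_mul_schurVal (x : ℕ → R) (n k : ℕ) (ν : YoungDiagram) :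
    hsym (omegaSeq (powSums x n)) k * schurVal x n ν =
      ∑ μ ∈ partitionsOf (ν.card + k) with VStrip ν μ, schurVal x n μ := by
  rw [hsym_omegaSeq, mul_assoc, hsym_neg_mul_schurVal, ← mul_assoc, ← pow_add,
    Even.neg_one_pow ⟨_, rfl⟩, one_mul]

end Pieri

/-! ### Littlewood's identities from a balance condition -/

/-- A family `S` of partitions is balanced with respect to a strip relation `A` if for every `μ`
there are as many `λ ∈ S` such that `λ / μ` is a horizontal strip as there are `ν ∈ S` with
`A ν μ`, with sizes reflected at `|μ|`. -/
structure Balanced (S : YoungDiagram → Prop) (A : YoungDiagram → YoungDiagram → Prop) : Prop where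
  bot : S ⊥
  card_le : ∀ μ lam, S lam → HStrip μ lam → lam.card ≤ 2 * μ.card
  card_eq : ∀ μ a b, a + b = 2 * μ.card →
    ((partitionsOf a).filter fun lam => S lam ∧ HStrip μ lam).card =
      ((partitionsOf b).filter fun ν => S ν ∧ A ν μ).card

section Littlewood

variable {R : Type*} [CommRing R]

/-- The power sums of the products `x i * x j` for `i < j < n`. -/
def pairPowSums (x : ℕ → R) (n : ℕ) (r : ℕ+) : R :=
  ∑ j ∈ Finset.range n, ∑ i ∈ Finset.range j, (x i * x j) ^ (r : ℕ)

theorem pairPowSums_succ (x : ℕ → R) (n : ℕ) (r : ℕ+) :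
    pairPowSums x (n + 1) r = pairPowSums x n r + x n ^ (r : ℕ) * powSums x n r := by
  rw [pairPowSums, Finset.sum_range_succ, pairPowSums, powSums, Finset.mul_sum]
  congr 1
  refine Finset.sum_congr rfl fun i _ => ?_
  rw [mul_pow, mul_comm]

/-- The sign sequence `ε` treats both families at once: `ε = 1` yields complete functions and
horizontal strips, `ε r = (-1)^(r+1)` elementary functions and vertical strips. -/
theorem littlewood [Algebra ℚ R] {S : YoungDiagram → Prop} {A : YoungDiagram → YoungDiagram → Prop}
    (hS : Balanced S A) (ε : ℕ+ → R) (x : ℕ → R)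
    (hP : ∀ n k ν, hsym (fun r => ε r * powSums x n r) k * schurVal x n ν =
      ∑ μ ∈ partitionsOf (ν.card + k) with A ν μ, schurVal x n μ) (n h : ℕ) :
    hsym (fun r => ε r * pairPowSums x n r) h =
      ∑ μ ∈ partitionsOf (2 * h) with S μ, schurVal x n μ := by
  induction n generalizing h with
  | zero =>
    have h0 : (fun r => ε r * pairPowSums x 0 r) = fun _ => 0 := by
      ext r
      simp [pairPowSums]
    rw [h0, hsym_zero_left]
    simp only [schurVal_zero]
    rw [Finset.sum_ite_eq']
    simp [hS.bot, eq_comm]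
  | succ n ih =>
    have h1 : (fun r => ε r * pairPowSums x (n + 1) r) = fun r =>
        ε r * pairPowSums x n r + x n ^ (r : ℕ) * (ε r * powSums x n r) := by
      ext r
      rw [pairPowSums_succ]
      ring
    rw [h1, hsym_add]
    simp only [hsym_pow_mul]
    have hL : ∀ p ∈ Finset.HasAntidiagonal.antidiagonal h,
        hsym (fun r => ε r * pairPowSums x n r) p.1 *
          (x n ^ p.2 * hsym (fun r => ε r * powSums x n r) p.2) =
        ∑ μ ∈ partitionsUpTo (2 * h), if p.2 + μ.card = 2 * h then
          ((partitionsOf (2 * p.1)).filter fun ν => S ν ∧ A ν μ).card •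
            (x n ^ (2 * h - μ.card) * schurVal x n μ) else 0 := by
      intro p hp
      have hp := Finset.HasAntidiagonal.mem_antidiagonal.1 hp
      rw [ih, Finset.sum_mul, ← Finset.sum_filter]
      have e1 : ∀ ν ∈ (partitionsOf (2 * p.1)).filter fun ν => S ν,
          schurVal x n ν * (x n ^ p.2 * hsym (fun r => ε r * powSums x n r) p.2) =
          ∑ μ ∈ partitionsUpTo (2 * h) with p.2 + μ.card = 2 * h,
            if A ν μ then x n ^ (2 * h - μ.card) * schurVal x n μ else 0 := by
        intro ν hν
        have hν := mem_partitionsOf.1 (Finset.mem_filter.1 hν).1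
        rw [← Finset.sum_filter, mul_left_comm, mul_comm (schurVal x n ν), hP, Finset.mul_sum]
        refine Finset.sum_congr ?_ ?_
        · ext μ
          simp only [Finset.mem_filter, mem_partitionsOf, mem_partitionsUpTo]
          refine and_congr_left fun _ => ?_
          omega
        · intro μ hμ
          have hμ := (Finset.mem_filter.1 (Finset.mem_filter.1 hμ).1).2
          congr 2
          omega
      rw [Finset.sum_congr rfl e1, Finset.sum_comm]
      refine Finset.sum_congr rfl fun μ _ => ?_
      rw [← Finset.sum_filter, Finset.sum_const, Finset.filter_filter]
    have hR : ∀ lam ∈ (partitionsOf (2 * h)).filter (fun lam => S lam),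
        schurVal x (n + 1) lam = ∑ μ ∈ partitionsUpTo (2 * h), if HStrip μ lam then
          x n ^ (2 * h - μ.card) * schurVal x n μ else 0 := by
      intro lam hlam
      rw [schurVal_succ, ← Finset.sum_filter, mem_partitionsOf.1 (Finset.mem_filter.1 hlam).1]
    rw [Finset.sum_congr rfl hL, Finset.sum_congr rfl hR, Finset.sum_comm,
      Finset.sum_comm (s := (partitionsOf (2 * h)).filter (fun lam => S lam))]
    refine Finset.sum_congr rfl fun μ hμ => ?_
    rw [mem_partitionsUpTo] at hμ
    rw [← Finset.sum_filter (s := (partitionsOf (2 * h)).filter fun lam => S lam),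
      Finset.sum_const, Finset.filter_filter]
    -- On the left, `|ν| = 2a`, `|μ| = 2a + c` and `a + c = h` force `a = |μ| - h` and `c = 2h -
    -- |μ|`. Hence one term survives if `h ≤ |μ|`; otherwise there is none, and `card_le` empties
    -- the right side too.
    by_cases hm : h ≤ μ.card
    · rw [Finset.sum_eq_single_of_mem (μ.card - h, 2 * h - μ.card)]
      · rw [if_pos (by dsimp only; omega)]
        congr 1
        exact (hS.card_eq μ _ _ (by dsimp only; omega)).symm
      · rw [Finset.HasAntidiagonal.mem_antidiagonal]
        dsimp only
        omega
      · rintro ⟨a, b⟩ hp hne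
        have hp : a + b = h := Finset.HasAntidiagonal.mem_antidiagonal.1 hp
        rw [if_neg]
        intro hc
        apply hne
        rw [Prod.mk.injEq]
        dsimp only at hc
        omega
    · have : ((partitionsOf (2 * h)).filter fun lam => S lam ∧ HStrip μ lam) = ∅ := by
        refine Finset.filter_eq_empty_iff.2 ?_
        rintro lam hlam ⟨h2, h3⟩
        have := hS.card_le μ lam h2 h3
        rw [mem_partitionsOf] at hlam
        omega
      rw [this, Finset.card_empty, zero_smul]
      refine Finset.sum_eq_zero ?_
      rintro ⟨a, b⟩ hp
      have hp : a + b = h := Finset.HasAntidiagonal.mem_antidiagonal.1 hp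
      rw [if_neg (by dsimp only; omega)]

end Littlewood

/-! ### Even partitions -/

theorem isEven_bot : IsEven ⊥ := fun j => by simp

/-- The reflection of `ν` at `μ`, acting on column lengths. -/
def reflectCols (μ ν : YoungDiagram) : YoungDiagram :=
  (mkRows fun j => 2 * μ.colLen j - ν.colLen j).transpose

theorem colLen_card (μ : YoungDiagram) : μ.colLen μ.card = 0 := by
  rw [← YoungDiagram.rowLen_transpose, ← card_transpose]
  exact rowLen_card _

/-- A column of `ν` is `μ'_j` rounded to an even number, always up or always down, so the reflected
columns round the other way. Rounding preserves monotonicity, hence they form a partition. -/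
theorem colLen_reflectCols {μ ν : YoungDiagram} (hν : IsEven ν) (h : HStrip μ ν ∨ HStrip ν μ)
    (j : ℕ) : (reflectCols μ ν).colLen j = 2 * μ.colLen j - ν.colLen j := by
  rw [reflectCols, YoungDiagram.colLen_transpose]
  simp only [hStrip_iff_colLen] at h
  apply rowLen_mkRows (N := μ.card)
  · intro i
    have h3 := μ.colLen_anti i (i + 1) (Nat.le_succ i)
    obtain ⟨a, ha⟩ := hν i
    obtain ⟨b, hb⟩ := hν (i + 1)
    rcases h with h | h <;> have h1 := h i <;> have h2 := h (i + 1) <;> omega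
  · have := colLen_card μ
    omega

theorem le_two_mul_colLen {μ ν : YoungDiagram} (hν : IsEven ν) (h : HStrip μ ν ∨ HStrip ν μ)
    (j : ℕ) : ν.colLen j ≤ 2 * μ.colLen j := by
  simp only [hStrip_iff_colLen] at h
  obtain ⟨a, ha⟩ := hν j
  rcases h with h | h <;> have := h j <;> omega

theorem card_eq_sum_colLen_of_le (μ : YoungDiagram) {N : ℕ} (h : μ.card ≤ N) :
    μ.card = ∑ i ∈ Finset.range N, μ.colLen i := by
  rw [← card_transpose] at h ⊢
  simpa only [YoungDiagram.rowLen_transpose] using card_eq_sum_of_le _ h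

theorem card_add_card_reflectCols {μ ν : YoungDiagram} (hν : IsEven ν)
    (h : HStrip μ ν ∨ HStrip ν μ) : ν.card + (reflectCols μ ν).card = 2 * μ.card := by
  obtain ⟨N, h1, h2, h3⟩ : ∃ N, ν.card ≤ N ∧ (reflectCols μ ν).card ≤ N ∧ μ.card ≤ N :=
    ⟨ν.card + (reflectCols μ ν).card + μ.card, by omega, by omega, by omega⟩
  rw [card_eq_sum_colLen_of_le _ h1, card_eq_sum_colLen_of_le _ h2, card_eq_sum_colLen_of_le _ h3,
    Finset.mul_sum, ← Finset.sum_add_distrib]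
  refine Finset.sum_congr rfl fun j _ => ?_
  rw [colLen_reflectCols hν h]
  have := le_two_mul_colLen hν h j
  omega

theorem isEven_reflectCols {μ ν : YoungDiagram} (hν : IsEven ν) (h : HStrip μ ν ∨ HStrip ν μ) :
    IsEven (reflectCols μ ν) := by
  intro j
  rw [colLen_reflectCols hν h]
  obtain ⟨a, ha⟩ := hν j
  exact ⟨μ.colLen j - a, by omega⟩

theorem reflectCols_hStrip {μ ν : YoungDiagram} (hν : IsEven ν) (h : HStrip μ ν) :
    HStrip (reflectCols μ ν) μ := by
  refine hStrip_iff_colLen.2 fun j => ?_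
  rw [colLen_reflectCols hν (Or.inl h)]
  have := hStrip_iff_colLen.1 h j
  omega

theorem hStrip_reflectCols {μ ν : YoungDiagram} (hν : IsEven ν) (h : HStrip ν μ) :
    HStrip μ (reflectCols μ ν) := by
  refine hStrip_iff_colLen.2 fun j => ?_
  rw [colLen_reflectCols hν (Or.inr h)]
  have := hStrip_iff_colLen.1 h j
  omega

theorem reflectCols_reflectCols {μ ν : YoungDiagram} (hν : IsEven ν)
    (h : HStrip μ ν ∨ HStrip ν μ) : reflectCols μ (reflectCols μ ν) = ν := by
  apply ext_colLen
  intro j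
  rw [colLen_reflectCols (isEven_reflectCols hν h), colLen_reflectCols hν h]
  · have := le_two_mul_colLen hν h j
    omega
  · exact h.symm.imp (hStrip_reflectCols hν) (reflectCols_hStrip hν)

theorem balanced_isEven : Balanced IsEven HStrip where
  bot := isEven_bot
  card_le μ lam hl h := by
    have := card_add_card_reflectCols hl (Or.inl h)
    omega
  card_eq μ a b hab := by
    refine Finset.card_bij' (fun lam _ => reflectCols μ lam) (fun ν _ => reflectCols μ ν)
      ?_ ?_ ?_ ?_
    · intro lam h
      simp only [Finset.mem_filter, mem_partitionsOf] at h ⊢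
      obtain ⟨h0, h1, h2⟩ := h
      have hc := card_add_card_reflectCols h1 (Or.inl h2)
      exact ⟨by omega, isEven_reflectCols h1 (Or.inl h2), reflectCols_hStrip h1 h2⟩
    · intro ν h
      simp only [Finset.mem_filter, mem_partitionsOf] at h ⊢
      obtain ⟨h0, h1, h2⟩ := h
      have hc := card_add_card_reflectCols h1 (Or.inr h2)
      exact ⟨by omega, isEven_reflectCols h1 (Or.inr h2), hStrip_reflectCols h1 h2⟩
    · intro lam h
      obtain ⟨h1, h2⟩ := (Finset.mem_filter.1 h).2
      exact reflectCols_reflectCols h1 (Or.inl h2)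
    · intro ν h
      obtain ⟨h1, h2⟩ := (Finset.mem_filter.1 h).2
      exact reflectCols_reflectCols h1 (Or.inr h2)

/-! ### Threshold partitions -/

theorem exists_rank (μ : YoungDiagram) : ∃ d, ∀ i, (i, i) ∈ μ ↔ i < d := by
  have hex : ∃ d, (d, d) ∉ μ := by
    refine ⟨μ.card, fun h => ?_⟩
    have := YoungDiagram.mem_iff_lt_rowLen.1 h
    rw [rowLen_card] at this
    exact absurd this (Nat.not_lt_zero _)
  refine ⟨Nat.find hex, fun i => ⟨fun h => ?_, fun h => ?_⟩⟩
  · by_contra hc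
    exact Nat.find_spec hex (μ.up_left_mem (not_lt.1 hc) (not_lt.1 hc) h)
  · by_contra hc
    exact Nat.find_min hex h hc

/-- The size of a partition is the sum of the lengths of its diagonal hooks. -/
theorem card_eq_sum_hooks {μ : YoungDiagram} {d : ℕ} (hd : (d, d) ∉ μ) : μ.card =
    ∑ i ∈ Finset.range d, ((μ.rowLen i - i) + (μ.colLen i - (i + 1))) := by
  have hmaps : ∀ c ∈ μ.cells, min c.1 c.2 ∈ Finset.range d := by
    rintro ⟨i, j⟩ hc
    rw [Finset.mem_range]
    by_contra h
    exact hd (μ.up_left_mem (by dsimp only at h; omega) (by dsimp only at h; omega)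
      ((YoungDiagram.mem_cells _).1 hc))
  rw [YoungDiagram.card, Finset.card_eq_sum_card_fiberwise hmaps]
  refine Finset.sum_congr rfl fun k _ => ?_
  -- If `(k, k)` lies outside `μ`, the hook is empty and both truncated differences vanish; so `d`
  -- may exceed the length of the diagonal.
  have hset : μ.cells.filter (fun c => min c.1 c.2 = k) =
      ({k} ×ˢ Finset.Ico k (μ.rowLen k)) ∪ (Finset.Ico (k + 1) (μ.colLen k) ×ˢ {k}) := by
    ext ⟨i, j⟩
    simp only [Finset.mem_filter, YoungDiagram.mem_cells, Finset.mem_union, Finset.mem_product,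
      Finset.mem_singleton, Finset.mem_Ico]
    constructor
    · rintro ⟨h1, h2⟩
      have h3 := YoungDiagram.mem_iff_lt_rowLen.1 h1
      have h4 := YoungDiagram.mem_iff_lt_colLen.1 h1
      by_cases hij : i ≤ j
      · have : i = k := by omega
        subst this
        omega
      · have : j = k := by omega
        subst this
        omega
    · rintro (⟨rfl, h1, h2⟩ | ⟨⟨h1, h2⟩, rfl⟩)
      · exact ⟨YoungDiagram.mem_iff_lt_rowLen.2 h2, by omega⟩
      · exact ⟨YoungDiagram.mem_iff_lt_colLen.2 h2, by omega⟩
  have hdisj : Disjoint ({k} ×ˢ Finset.Ico k (μ.rowLen k) : Finset (ℕ × ℕ))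
      (Finset.Ico (k + 1) (μ.colLen k) ×ˢ {k}) := by
    rw [Finset.disjoint_left]
    rintro ⟨i, j⟩ h1 h2
    simp only [Finset.mem_product, Finset.mem_singleton, Finset.mem_Ico] at h1 h2
    omega
  rw [hset, Finset.card_union_of_disjoint hdisj]
  simp

/-- The partition obtained by doubling the shifted diagram with row ends `r 0 ≥ r 1 ≥ ⋯`. -/
def doubled (d : ℕ) (r : ℕ → ℕ) (hr : ∀ i, i + 1 < d → r (i + 1) ≤ r i) : YoungDiagram where
  cells := (Finset.range (r 0 + d + 1) ×ˢ Finset.range (r 0 + d + 1)).filter fun c =>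
    (c.1 ≤ c.2 ∧ c.1 < d ∧ c.2 < r c.1) ∨ (c.2 < c.1 ∧ c.2 < d ∧ c.1 ≤ r c.2)
  isLowerSet := by
    have hanti : ∀ i j, i ≤ j → j < d → r j ≤ r i := by
      intro i j hij
      induction j, hij using Nat.le_induction with
      | base => exact fun _ => le_rfl
      | succ j _ ih => exact fun hj => (hr j hj).trans (ih (by omega))
    rintro ⟨i, j⟩ ⟨i', j'⟩ ⟨hi, hj⟩ h
    simp only [Finset.coe_filter, Finset.mem_product, Finset.mem_range, Set.mem_ofPred_eq] at h ⊢
    simp only at hi hj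
    refine ⟨by omega, ?_⟩
    rcases h.2 with h1 | h1
    · have a1 := hanti i' i hi h1.2.1
      by_cases h2 : i' ≤ j'
      · left
        omega
      · right
        have a2 := hanti j' i (by omega) h1.2.1
        omega
    · have a1 := hanti j' j hj h1.2.1
      by_cases h2 : i' ≤ j'
      · left
        have a2 := hanti i' j (by omega) h1.2.1
        omega
      · right
        omega

theorem antitone_of_step {d : ℕ} {r : ℕ → ℕ} (hr : ∀ i, i + 1 < d → r (i + 1) ≤ r i) {i j : ℕ}
    (hij : i ≤ j) (hj : j < d) : r j ≤ r i := by
  induction j, hij using Nat.le_induction with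
  | base => exact le_rfl
  | succ j _ ih => exact (hr j hj).trans (ih (by omega))

theorem mem_doubled {d : ℕ} {r : ℕ → ℕ} {hr : ∀ i, i + 1 < d → r (i + 1) ≤ r i} {i j : ℕ} :
    (i, j) ∈ doubled d r hr ↔ (i ≤ j ∧ i < d ∧ j < r i) ∨ (j < i ∧ j < d ∧ i ≤ r j) := by
  rw [← YoungDiagram.mem_cells]
  simp only [doubled, Finset.mem_filter, Finset.mem_product, Finset.mem_range,
    and_iff_right_iff_imp]
  rintro (h | h)
  · have := antitone_of_step hr (Nat.zero_le i) h.2.1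
    omega
  · have := antitone_of_step hr (Nat.zero_le j) h.2.1
    omega

/-! ### Row and column lengths of doubled diagrams -/

section Doubled

variable {d : ℕ} {r : ℕ → ℕ} {hr : ∀ i, i + 1 < d → r (i + 1) ≤ r i}

/-- The bound on `r` admits `r (d - 1) = d - 1`, where the last diagonal hook is empty. This is
needed for a `ν` whose diagonal is one shorter than that of `μ`. -/
theorem rowLen_doubled (hdr : ∀ i, i < d → d ≤ r i + 1) {i : ℕ} (hi : i < d) :
    (doubled d r hr).rowLen i = r i := by
  apply rowLen_eq_of_mem_iff
  intro j
  rw [mem_doubled]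
  have := hdr i hi
  by_cases hij : i ≤ j
  · omega
  · have := hdr j (by omega)
    omega

theorem colLen_doubled {i : ℕ} (hi : i < d) (hir : i < r i) :
    (doubled d r hr).colLen i = r i + 1 := by
  apply colLen_eq_of_mem_iff
  intro k
  rw [mem_doubled]
  by_cases hki : k ≤ i
  · have := antitone_of_step hr hki hi
    omega
  · omega

theorem isThreshold_doubled (hdr : ∀ i, i < d → d ≤ r i + 1) : IsThreshold (doubled d r hr) := by
  intro i hi
  rw [mem_doubled] at hi
  rw [rowLen_doubled hdr (by omega), colLen_doubled (by omega) (by omega)]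

end Doubled

theorem IsThreshold.mem_iff {lam : YoungDiagram} (hl : IsThreshold lam) {d : ℕ}
    (hd : (d, d) ∉ lam) (i j : ℕ) : (i, j) ∈ lam ↔
      (i ≤ j ∧ i < d ∧ j < lam.rowLen i) ∨ (j < i ∧ j < d ∧ i ≤ lam.rowLen j) := by
  have hlt : ∀ k, (k, k) ∈ lam → k < d := by
    intro k hk
    by_contra hc
    exact hd (lam.up_left_mem (not_lt.1 hc) (not_lt.1 hc) hk)
  by_cases hij : i ≤ j
  · rw [YoungDiagram.mem_iff_lt_rowLen]
    constructor
    · intro h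
      have := hlt i (lam.up_left_mem le_rfl hij (YoungDiagram.mem_iff_lt_rowLen.2 h))
      omega
    · omega
  · constructor
    · intro h
      have h1 : (j, j) ∈ lam := lam.up_left_mem (by omega) le_rfl h
      have := hlt j h1
      have := hl j h1
      have := YoungDiagram.mem_iff_lt_colLen.1 h
      omega
    · intro h
      have h1 : (j, j) ∈ lam := by
        rw [YoungDiagram.mem_iff_lt_rowLen]
        omega
      have := hl j h1
      rw [YoungDiagram.mem_iff_lt_colLen]
      omega

theorem IsThreshold.eq_doubled {lam : YoungDiagram} (hl : IsThreshold lam) {d : ℕ}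
    (hd : (d, d) ∉ lam) {r : ℕ → ℕ} (hr : ∀ i, i + 1 < d → r (i + 1) ≤ r i)
    (h : ∀ i, i < d → r i = lam.rowLen i) : doubled d r hr = lam := by
  apply ext_mem
  intro i j
  rw [mem_doubled, hl.mem_iff hd]
  by_cases hi : i < d
  · by_cases hj : j < d
    · rw [h i hi, h j hj]
    · rw [h i hi]
      omega
  · by_cases hj : j < d
    · rw [h j hj]
      omega
    · omega

theorem isThreshold_bot : IsThreshold ⊥ := fun _ h => absurd h (YoungDiagram.notMem_bot _)

/-! #### Parametrization of threshold partitions near a fixed partition -/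

section Param

variable {μ : YoungDiagram} {d : ℕ}

theorem le_rowLen_of_rank (hd : ∀ i, (i, i) ∈ μ ↔ i < d) {i : ℕ} (hi : i < d) :
    d ≤ μ.rowLen i := by
  have := YoungDiagram.mem_iff_lt_rowLen.1
    (μ.up_left_mem (show i ≤ d - 1 by omega) le_rfl ((hd (d - 1)).2 (by omega)))
  omega

theorem le_colLen_of_rank (hd : ∀ i, (i, i) ∈ μ ↔ i < d) {i : ℕ} (hi : i < d) :
    d ≤ μ.colLen i := by
  have := YoungDiagram.mem_iff_lt_colLen.1
    (μ.up_left_mem le_rfl (show i ≤ d - 1 by omega) ((hd (d - 1)).2 (by omega)))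
  omega

theorem colLen_rank_le (hd : ∀ i, (i, i) ∈ μ ↔ i < d) : μ.colLen d ≤ d := by
  by_contra hc
  have := (hd d).1 (YoungDiagram.mem_iff_lt_colLen.2 (not_le.1 hc))
  omega

/-- The length of the row above row `i`; above row `0` the bound `μ.colLen 0` is used. -/
def rowAbove (μ : YoungDiagram) (i : ℕ) : ℕ := if i = 0 then μ.colLen 0 else μ.rowLen (i - 1)

/-- The possible lengths of the `i`-th row of a threshold partition `λ` such that `λ / μ` is a
horizontal strip. -/
def outerRows (μ : YoungDiagram) (i : ℕ) : Finset ℕ :=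
  Finset.Icc (max (μ.rowLen i) (μ.colLen i - 1)) (min (μ.colLen i) (rowAbove μ i))

/-- The possible lengths of the `i`-th row of a threshold partition `ν` such that `μ / ν` is a
vertical strip. -/
def innerRows (μ : YoungDiagram) (i : ℕ) : Finset ℕ :=
  Finset.Icc (max (μ.rowLen i) (μ.colLen (i + 1)) - 1) (min (μ.rowLen i) (μ.colLen i - 1))

/-- Extension by zero. -/
def extendFin {d : ℕ} (f : Fin d → ℕ) (i : ℕ) : ℕ := if h : i < d then f ⟨i, h⟩ else 0

theorem extendFin_of_lt (f : Fin d → ℕ) {i : ℕ} (h : i < d) : extendFin f i = f ⟨i, h⟩ := dif_pos h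

/-- The threshold condition at `(d, d)` would put the cell `(d + 1, d)` below it into `lam`, and
then the strip condition puts `(d, d)` into `μ`. So adding the strip does not lengthen the diagonal.
-/
theorem outer_notMem (hd : ∀ i, (i, i) ∈ μ ↔ i < d) {lam : YoungDiagram} (hl : IsThreshold lam)
    (hs : HStrip μ lam) : (d, d) ∉ lam := by
  intro h
  have h1 := hl d h
  have h2 := YoungDiagram.mem_iff_lt_rowLen.1 h
  have h3 : (d + 1, d) ∈ lam := YoungDiagram.mem_iff_lt_colLen.2 (by omega)
  have := (hd d).1 ((hStrip_iff_mem.1 hs).2 d d h3)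
  omega

theorem outer_bounds (hd : ∀ i, (i, i) ∈ μ ↔ i < d) {lam : YoungDiagram} (hl : IsThreshold lam)
    (hs : HStrip μ lam) {i : ℕ} (hi : i < d) :
    lam.colLen i = lam.rowLen i + 1 ∧ lam.rowLen i ∈ outerRows μ i := by
  have h1 := hl i ((hStrip_iff_mem.1 hs).1 _ _ ((hd i).2 hi))
  have h2 := hStrip_iff_colLen.1 hs i
  have h3 := hs i
  refine ⟨h1, ?_⟩
  rw [outerRows, Finset.mem_Icc, rowAbove]
  rcases i with _ | i
  · rw [if_pos rfl]
    omega
  · rw [if_neg (Nat.succ_ne_zero i), Nat.add_sub_cancel]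
    have := hs i
    omega

theorem inner_notMem (hd : ∀ i, (i, i) ∈ μ ↔ i < d) {ν : YoungDiagram}
    (hs : VStrip ν μ) : (d, d) ∉ ν := by
  intro h
  have := (hd d).1 ((vStrip_iff_mem.1 hs).1 _ _ h)
  omega

/-- The diagonal of `ν` can be shorter than that of `μ` only by its last cell. Then `ν_i = i` for `i
= d - 1`, the hook is empty, and truncated subtraction keeps the formulas valid. -/
theorem inner_bounds (hd : ∀ i, (i, i) ∈ μ ↔ i < d) {ν : YoungDiagram} (hν : IsThreshold ν)
    (hs : VStrip ν μ) {i : ℕ} (hi : i < d) :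
    i ≤ ν.rowLen i ∧ ν.colLen i - (i + 1) = ν.rowLen i - i ∧ ν.rowLen i ∈ innerRows μ i := by
  have h1 := hs i
  have h2 := vStrip_iff_colLen.1 hs i
  have h3 := le_rowLen_of_rank hd hi
  have h4 := le_colLen_of_rank hd hi
  rw [innerRows, Finset.mem_Icc]
  by_cases h : (i, i) ∈ ν
  · have h5 := hν i h
    omega
  · have h5 : ν.rowLen i ≤ i := by
      by_contra hc
      exact h (YoungDiagram.mem_iff_lt_rowLen.2 (not_le.1 hc))
    have h6 : ν.colLen i ≤ i := by
      by_contra hc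
      exact h (YoungDiagram.mem_iff_lt_colLen.2 (not_le.1 hc))
    have h7 : i + 1 = d := by omega
    have h8 := colLen_rank_le hd
    rw [← h7] at h8
    omega

theorem card_outer (hd : ∀ i, (i, i) ∈ μ ↔ i < d) {lam : YoungDiagram} (hl : IsThreshold lam)
    (hs : HStrip μ lam) : lam.card = μ.card + ∑ i ∈ Finset.range d,
      ((lam.rowLen i - μ.rowLen i) + (lam.rowLen i + 1 - μ.colLen i)) := by
  rw [card_eq_sum_hooks (outer_notMem hd hl hs),
    card_eq_sum_hooks (μ := μ) (d := d) (by rw [hd]; omega), ← Finset.sum_add_distrib]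
  refine Finset.sum_congr rfl fun i hi => ?_
  have hi := Finset.mem_range.1 hi
  obtain ⟨h1, h2⟩ := outer_bounds hd hl hs hi
  rw [outerRows, Finset.mem_Icc] at h2
  have h3 := le_rowLen_of_rank hd hi
  have h4 := le_colLen_of_rank hd hi
  omega

theorem card_inner (hd : ∀ i, (i, i) ∈ μ ↔ i < d) {ν : YoungDiagram} (hν : IsThreshold ν)
    (hs : VStrip ν μ) : μ.card = ν.card + ∑ i ∈ Finset.range d,
      ((μ.rowLen i - ν.rowLen i) + (μ.colLen i - (ν.rowLen i + 1))) := by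
  rw [card_eq_sum_hooks (inner_notMem hd hs),
    card_eq_sum_hooks (μ := μ) (d := d) (by rw [hd]; omega), ← Finset.sum_add_distrib]
  refine Finset.sum_congr rfl fun i hi => ?_
  have hi := Finset.mem_range.1 hi
  obtain ⟨h1, h2, h5⟩ := inner_bounds hd hν hs hi
  rw [innerRows, Finset.mem_Icc] at h5
  have h3 := le_rowLen_of_rank hd hi
  have h4 := le_colLen_of_rank hd hi
  omega

theorem outer_step {f : ℕ → ℕ} (hf : ∀ i, i < d → f i ∈ outerRows μ i) (i : ℕ) (hi : i + 1 < d) :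
    f (i + 1) ≤ f i := by
  have h1 := hf (i + 1) hi
  have h2 := hf i (by omega)
  rw [outerRows, Finset.mem_Icc, rowAbove] at h1 h2
  rw [if_neg (Nat.succ_ne_zero i), Nat.add_sub_cancel] at h1
  omega

theorem inner_step (hd : ∀ i, (i, i) ∈ μ ↔ i < d) {f : ℕ → ℕ}
    (hf : ∀ i, i < d → f i ∈ innerRows μ i) (i : ℕ) (hi : i + 1 < d) : f (i + 1) ≤ f i := by
  have h1 := hf (i + 1) hi
  have h2 := hf i (by omega)
  have h3 := le_colLen_of_rank hd hi
  rw [innerRows, Finset.mem_Icc] at h1 h2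
  omega

theorem outer_rank_le (hd : ∀ i, (i, i) ∈ μ ↔ i < d) {f : ℕ → ℕ}
    (hf : ∀ i, i < d → f i ∈ outerRows μ i) (i : ℕ) (hi : i < d) : d ≤ f i + 1 := by
  have h1 := hf i hi
  have h3 := le_rowLen_of_rank hd hi
  rw [outerRows, Finset.mem_Icc] at h1
  omega

theorem inner_rank_le (hd : ∀ i, (i, i) ∈ μ ↔ i < d) {f : ℕ → ℕ}
    (hf : ∀ i, i < d → f i ∈ innerRows μ i) (i : ℕ) (hi : i < d) : d ≤ f i + 1 := by
  have h1 := hf i hi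
  have h3 := le_rowLen_of_rank hd hi
  rw [innerRows, Finset.mem_Icc] at h1
  omega

theorem hStrip_doubled (hd : ∀ i, (i, i) ∈ μ ↔ i < d) {f : ℕ → ℕ}
    (hf : ∀ i, i < d → f i ∈ outerRows μ i) : HStrip μ (doubled d f (outer_step hf)) := by
  simp only [outerRows, Finset.mem_Icc, rowAbove] at hf
  refine hStrip_iff_mem.2 ⟨fun i j h => ?_, fun i j h => ?_⟩
  · rw [mem_doubled]
    by_cases hij : i ≤ j
    · have h1 := (hd i).1 (μ.up_left_mem le_rfl hij h)
      have := hf i h1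
      have := YoungDiagram.mem_iff_lt_rowLen.1 h
      omega
    · have h1 := (hd j).1 (μ.up_left_mem (by omega) le_rfl h)
      have := hf j h1
      have := YoungDiagram.mem_iff_lt_colLen.1 h
      omega
  · rw [mem_doubled] at h
    rcases h with h | h
    · have := hf (i + 1) h.2.1
      rw [if_neg (Nat.succ_ne_zero i), Nat.add_sub_cancel] at this
      rw [YoungDiagram.mem_iff_lt_rowLen]
      omega
    · have := hf j h.2.1
      rw [YoungDiagram.mem_iff_lt_colLen]
      omega

theorem vStrip_doubled (hd : ∀ i, (i, i) ∈ μ ↔ i < d) {f : ℕ → ℕ}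
    (hf : ∀ i, i < d → f i ∈ innerRows μ i) : VStrip (doubled d f (inner_step hd hf)) μ := by
  simp only [innerRows, Finset.mem_Icc] at hf
  refine vStrip_iff_mem.2 ⟨fun i j h => ?_, fun i j h => ?_⟩
  · rw [mem_doubled] at h
    rcases h with h | h
    · have := hf i h.2.1
      rw [YoungDiagram.mem_iff_lt_rowLen]
      omega
    · have := hf j h.2.1
      have := le_colLen_of_rank hd h.2.1
      rw [YoungDiagram.mem_iff_lt_colLen]
      omega
  · rw [mem_doubled]
    by_cases hij : i ≤ j
    · have h1 := (hd i).1 (μ.up_left_mem le_rfl (by omega) h)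
      have := hf i h1
      have := YoungDiagram.mem_iff_lt_rowLen.1 h
      omega
    · have h1 := (hd (j + 1)).1 (μ.up_left_mem (by omega) le_rfl h)
      have := hf j (by omega)
      have := YoungDiagram.mem_iff_lt_colLen.1 h
      omega

/-- The intervals `outerRows` involve only `μ`, so the rows of `λ` can be chosen independently of
each other. This makes the generating function by size a product over the diagonal. -/
theorem card_outer_eq (hd : ∀ i, (i, i) ∈ μ ↔ i < d) (k : ℕ) :
    ((partitionsOf (μ.card + k)).filter fun lam => IsThreshold lam ∧ HStrip μ lam).card =
      ((Fintype.piFinset fun i : Fin d => outerRows μ i).filter fun f : Fin d → ℕ =>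
        ∑ i : Fin d, ((f i - μ.rowLen i) + (f i + 1 - μ.colLen i)) = k).card := by
  have hf : ∀ f ∈ (Fintype.piFinset fun i : Fin d => outerRows μ i).filter fun f : Fin d → ℕ =>
      ∑ i : Fin d, ((f i - μ.rowLen i) + (f i + 1 - μ.colLen i)) = k,
      ∀ i, i < d → extendFin f i ∈ outerRows μ i := by
    intro f h i hi
    rw [extendFin_of_lt f hi]
    exact Fintype.mem_piFinset.1 (Finset.mem_filter.1 h).1 ⟨i, hi⟩
  refine Finset.card_bij' (fun lam _ (i : Fin d) => lam.rowLen i)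
    (fun f h => doubled d (extendFin f) (outer_step (hf f h))) ?_ ?_ ?_ ?_
  · intro lam h
    simp only [Finset.mem_filter, mem_partitionsOf, Fintype.mem_piFinset] at h ⊢
    obtain ⟨h0, h1, h2⟩ := h
    refine ⟨fun i => (outer_bounds hd h1 h2 i.2).2, ?_⟩
    have := card_outer hd h1 h2
    rw [Fin.sum_univ_eq_sum_range (fun i => (lam.rowLen i - μ.rowLen i) +
      (lam.rowLen i + 1 - μ.colLen i))]
    omega
  · intro f h
    have h1 : IsThreshold (doubled d (extendFin f) (outer_step (hf f h))) :=
      isThreshold_doubled (outer_rank_le hd (hf f h))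
    have h2 := hStrip_doubled hd (hf f h)
    have h3 := (Finset.mem_filter.1 h).2
    simp only [Finset.mem_filter, mem_partitionsOf]
    refine ⟨?_, h1, h2⟩
    rw [card_outer hd h1 h2, ← h3, ← Fin.sum_univ_eq_sum_range (fun i =>
      ((doubled d (extendFin f) (outer_step (hf f h))).rowLen i - μ.rowLen i) +
      ((doubled d (extendFin f) (outer_step (hf f h))).rowLen i + 1 - μ.colLen i))]
    congr 1
    refine Finset.sum_congr rfl fun i _ => ?_
    rw [rowLen_doubled (outer_rank_le hd (hf f h)) i.2, extendFin_of_lt f i.2]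
  · intro lam h
    have h' := (Finset.mem_filter.1 h).2
    exact h'.1.eq_doubled (outer_notMem hd h'.1 h'.2) _ fun i hi => extendFin_of_lt _ hi
  · intro f h
    funext i
    rw [rowLen_doubled (outer_rank_le hd (hf f h)) i.2, extendFin_of_lt f i.2]

theorem card_inner_eq (hd : ∀ i, (i, i) ∈ μ ↔ i < d) {k b : ℕ} (hb : b + k = μ.card) :
    ((partitionsOf b).filter fun ν => IsThreshold ν ∧ VStrip ν μ).card =
      ((Fintype.piFinset fun i : Fin d => innerRows μ i).filter fun f : Fin d → ℕ =>
        ∑ i : Fin d, ((μ.rowLen i - f i) + (μ.colLen i - (f i + 1))) = k).card := by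
  have hf : ∀ f ∈ (Fintype.piFinset fun i : Fin d => innerRows μ i).filter fun f : Fin d → ℕ =>
      ∑ i : Fin d, ((μ.rowLen i - f i) + (μ.colLen i - (f i + 1))) = k,
      ∀ i, i < d → extendFin f i ∈ innerRows μ i := by
    intro f h i hi
    rw [extendFin_of_lt f hi]
    exact Fintype.mem_piFinset.1 (Finset.mem_filter.1 h).1 ⟨i, hi⟩
  refine Finset.card_bij' (fun lam _ (i : Fin d) => lam.rowLen i)
    (fun f h => doubled d (extendFin f) (inner_step hd (hf f h))) ?_ ?_ ?_ ?_
  · intro ν h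
    simp only [Finset.mem_filter, mem_partitionsOf, Fintype.mem_piFinset] at h ⊢
    obtain ⟨h0, h1, h2⟩ := h
    refine ⟨fun i => (inner_bounds hd h1 h2 i.2).2.2, ?_⟩
    have := card_inner hd h1 h2
    rw [Fin.sum_univ_eq_sum_range (fun i => (μ.rowLen i - ν.rowLen i) +
      (μ.colLen i - (ν.rowLen i + 1)))]
    omega
  · intro f h
    have h1 : IsThreshold (doubled d (extendFin f) (inner_step hd (hf f h))) :=
      isThreshold_doubled (inner_rank_le hd (hf f h))
    have h2 := vStrip_doubled hd (hf f h)
    have h3 := (Finset.mem_filter.1 h).2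
    simp only [Finset.mem_filter, mem_partitionsOf]
    refine ⟨?_, h1, h2⟩
    have h4 := card_inner hd h1 h2
    have h5 : ∑ i ∈ Finset.range d,
        ((μ.rowLen i - (doubled d (extendFin f) (inner_step hd (hf f h))).rowLen i) +
        (μ.colLen i - ((doubled d (extendFin f) (inner_step hd (hf f h))).rowLen i + 1))) = k := by
      rw [← h3, ← Fin.sum_univ_eq_sum_range (fun i =>
        (μ.rowLen i - (doubled d (extendFin f) (inner_step hd (hf f h))).rowLen i) +
        (μ.colLen i - ((doubled d (extendFin f) (inner_step hd (hf f h))).rowLen i + 1)))]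
      refine Finset.sum_congr rfl fun i _ => ?_
      rw [rowLen_doubled (inner_rank_le hd (hf f h)) i.2, extendFin_of_lt f i.2]
    omega
  · intro ν h
    have h' := (Finset.mem_filter.1 h).2
    exact h'.1.eq_doubled (inner_notMem hd h'.2) _ fun i hi => extendFin_of_lt _ hi
  · intro f h
    funext i
    rw [rowLen_doubled (inner_rank_le hd (hf f h)) i.2, extendFin_of_lt f i.2]

end Param

/-! #### Comparing the generating functions -/

section GeneratingFunctions

open Polynomial

theorem coeff_prod_sum_X_pow {d : ℕ} (A : Fin d → Finset ℕ) (w : Fin d → ℕ → ℕ) (k : ℕ) :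
    (∏ i, ∑ a ∈ A i, (X : ℤ[X]) ^ w i a).coeff k =
      (((Fintype.piFinset A).filter fun f => ∑ i, w i (f i) = k).card : ℤ) := by
  rw [Finset.prod_univ_sum, Polynomial.finsetSum_coeff, Finset.card_filter, Nat.cast_sum]
  refine Finset.sum_congr rfl fun f _ => ?_
  rw [Finset.prod_pow_eq_pow_sum, Polynomial.coeff_X_pow]
  by_cases h : k = ∑ i, w i (f i)
  · rw [if_pos h, if_pos h.symm, Nat.cast_one]
  · rw [if_neg h, if_neg (Ne.symm h), Nat.cast_zero]

/-- The factor measuring whether a gap is positive. -/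
def gapFactor (v : ℕ) : ℤ[X] := if v = 0 then 1 else 1 + X ^ 2

theorem gapFactor_ne_zero (v : ℕ) : gapFactor v ≠ 0 := by
  rw [gapFactor]
  split_ifs
  · exact one_ne_zero
  · intro h
    have := congrArg (Polynomial.coeff · 2) h
    simp [Polynomial.coeff_one] at this

/-- Here `b = μ_i`, `c = μ'_i`, `B` is the row above and `e = μ'_{i+1}`. If `b < c`, each interval
holds one or two values with exponents differing by `2`; the second value exists exactly when the
corresponding gap is positive. If `b = c`, both intervals are singletons and both gaps are positive.
-/
theorem sum_Icc_mul_gapFactor {b c B e : ℕ} (hb : 1 ≤ b) (hbc : b ≤ c) (hbB : b ≤ B)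
    (hcB : c ≤ B + 1) (hec : e ≤ c) (heb : e ≤ b + 1) :
    (∑ R ∈ Finset.Icc (max b (c - 1)) (min c B), (X : ℤ[X]) ^ ((R - b) + (R + 1 - c))) *
        gapFactor (b + 1 - e) =
      (∑ r ∈ Finset.Icc (max b e - 1) (min b (c - 1)), (X : ℤ[X]) ^ ((b - r) + (c - (r + 1)))) *
        gapFactor (B + 1 - c) := by
  obtain ⟨u, rfl⟩ := Nat.exists_eq_add_of_le hbc
  obtain ⟨b, rfl⟩ := Nat.exists_eq_add_of_le' hb
  rcases u with _ | u
  · have e1 : max (b + 1) (b + 1 + 0 - 1) = b + 1 := by omega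
    have e2 : min (b + 1 + 0) B = b + 1 := by omega
    have e3 : max (b + 1) e - 1 = b := by omega
    have e4 : min (b + 1) (b + 1 + 0 - 1) = b := by omega
    rw [e1, e2, e3, e4, Finset.Icc_self, Finset.Icc_self, Finset.sum_singleton,
      Finset.sum_singleton, gapFactor, gapFactor, if_neg (by omega), if_neg (by omega)]
    congr 2
    omega
  · have p1 : ∀ u : ℕ, Finset.Icc u (u + 1) = {u, u + 1} := by
      intro u
      ext x
      simp only [Finset.mem_Icc, Finset.mem_insert, Finset.mem_singleton]
      omega
    have p2 : ∀ u : ℕ, u ∉ ({u + 1} : Finset ℕ) := by simp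
    have e1 : max (b + 1) (b + 1 + (u + 1) - 1) = b + u + 1 := by omega
    have e4 : min (b + 1) (b + 1 + (u + 1) - 1) = b + 1 := by omega
    have hL : ∑ R ∈ Finset.Icc (b + u + 1) (min (b + 1 + (u + 1)) B),
        (X : ℤ[X]) ^ ((R - (b + 1)) + (R + 1 - (b + 1 + (u + 1)))) =
        X ^ u * gapFactor (B + 1 - (b + 1 + (u + 1))) := by
      by_cases hv : B + 1 = b + 1 + (u + 1)
      · have e2 : min (b + 1 + (u + 1)) B = b + u + 1 := by omega
        rw [e2, Finset.Icc_self, Finset.sum_singleton, gapFactor, if_pos (by omega), mul_one]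
        congr 1
        omega
      · have e2 : min (b + 1 + (u + 1)) B = b + u + 1 + 1 := by omega
        rw [e2, p1, Finset.sum_insert (p2 _), Finset.sum_singleton, gapFactor, if_neg (by omega),
          mul_add, mul_one, ← pow_add]
        congr 2 <;> omega
    have hR : ∑ r ∈ Finset.Icc (max (b + 1) e - 1) (b + 1),
        (X : ℤ[X]) ^ ((b + 1 - r) + (b + 1 + (u + 1) - (r + 1))) =
        X ^ u * gapFactor (b + 1 + 1 - e) := by
      by_cases hv : e = b + 1 + 1
      · have e2 : max (b + 1) e - 1 = b + 1 := by omega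
        rw [e2, Finset.Icc_self, Finset.sum_singleton, gapFactor, if_pos (by omega), mul_one]
        congr 1
        omega
      · have e2 : max (b + 1) e - 1 = b := by omega
        rw [e2, p1, Finset.sum_insert (p2 _), Finset.sum_singleton, gapFactor, if_neg (by omega),
          mul_add, mul_one, ← pow_add, add_comm]
        congr 2 <;> omega
    rw [e1, e4, hL, hR]
    ring

/-- The gap between `μ_i` and `μ'_{i+1}` governs both the inner row `i` and the outer row `i + 1`.
In the product of the local identities the gap factors therefore agree up to a shift of index, and
they cancel. -/
theorem prod_outer_eq_prod_inner {μ : YoungDiagram} {d : ℕ} (hd : ∀ i, (i, i) ∈ μ ↔ i < d) :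
    ∏ i : Fin d, ∑ a ∈ outerRows μ i, (X : ℤ[X]) ^ ((a - μ.rowLen i) + (a + 1 - μ.colLen i)) =
      ∏ i : Fin d, ∑ a ∈ innerRows μ i,
        (X : ℤ[X]) ^ ((μ.rowLen i - a) + (μ.colLen i - (a + 1))) := by
  rw [Fin.prod_univ_eq_prod_range (fun i => ∑ a ∈ outerRows μ i,
      (X : ℤ[X]) ^ ((a - μ.rowLen i) + (a + 1 - μ.colLen i))),
    Fin.prod_univ_eq_prod_range (fun i => ∑ a ∈ innerRows μ i,
      (X : ℤ[X]) ^ ((μ.rowLen i - a) + (μ.colLen i - (a + 1))))]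
  -- If either inequality fails, some interval is empty on each side and both products vanish.
  by_cases hu : ∀ i, i < d → μ.rowLen i ≤ μ.colLen i
  · by_cases hv : ∀ i, i + 1 < d → μ.colLen (i + 1) ≤ μ.rowLen i + 1
    · let q : ℕ → ℤ[X] := fun i => gapFactor (rowAbove μ i + 1 - μ.colLen i)
      have hq : ∀ i, q (i + 1) = gapFactor (μ.rowLen i + 1 - μ.colLen (i + 1)) := by
        intro i
        simp only [q, rowAbove]
        rw [if_neg (Nat.succ_ne_zero i), Nat.add_sub_cancel]
      have hloc : ∀ i ∈ Finset.range d, (∑ a ∈ outerRows μ i,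
          (X : ℤ[X]) ^ ((a - μ.rowLen i) + (a + 1 - μ.colLen i))) * q (i + 1) =
          (∑ a ∈ innerRows μ i,
            (X : ℤ[X]) ^ ((μ.rowLen i - a) + (μ.colLen i - (a + 1)))) * q i := by
        intro i hi
        have hi := Finset.mem_range.1 hi
        have h1 := le_rowLen_of_rank hd hi
        have h2 := hu i hi
        have h3 := μ.colLen_anti i (i + 1) (Nat.le_succ i)
        rw [hq]
        apply sum_Icc_mul_gapFactor (by omega) h2
        · rw [rowAbove]
          rcases i with _ | i
          · exact h2
          · rw [if_neg (Nat.succ_ne_zero i), Nat.add_sub_cancel]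
            exact μ.rowLen_anti i (i + 1) (Nat.le_succ i)
        · rw [rowAbove]
          rcases i with _ | i
          · rw [if_pos rfl]
            omega
          · rw [if_neg (Nat.succ_ne_zero i), Nat.add_sub_cancel]
            exact hv i hi
        · exact h3
        · by_cases hi' : i + 1 < d
          · exact hv i hi'
          · have h4 : i + 1 = d := by omega
            have := colLen_rank_le hd
            rw [h4]
            omega
      have hprod := Finset.prod_congr (rfl : Finset.range d = Finset.range d) hloc
      rw [Finset.prod_mul_distrib, Finset.prod_mul_distrib] at hprod
      -- For `d > 0` both end gaps are positive: at `0` by the convention in `rowAbove`, at `d`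
      -- because `μ'_d ≤ d ≤ μ_{d-1}`.
      have hends : q d = q 0 := by
        rcases d with _ | d
        · rfl
        · rw [hq]
          simp only [q, rowAbove]
          have h1 := colLen_rank_le hd
          have h2 := le_rowLen_of_rank hd (Nat.lt_succ_self d)
          rw [gapFactor, gapFactor, if_neg (by omega), if_neg (by simp)]
      have hshift : ∏ i ∈ Finset.range d, q (i + 1) = ∏ i ∈ Finset.range d, q i := by
        have h1 := Finset.prod_range_succ q d
        rw [Finset.prod_range_succ', hends] at h1
        exact mul_right_cancel₀ (gapFactor_ne_zero _) h1
      rw [hshift] at hprod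
      exact mul_right_cancel₀ (Finset.prod_ne_zero_iff.2 fun i _ => gapFactor_ne_zero _) hprod
    · push Not at hv
      obtain ⟨i, hi, hlt⟩ := hv
      rw [Finset.prod_eq_zero (Finset.mem_range.2 hi), Finset.prod_eq_zero
        (Finset.mem_range.2 (show i < d by omega))]
      · rw [innerRows, Finset.Icc_eq_empty (by omega), Finset.sum_empty]
      · rw [outerRows, rowAbove, if_neg (Nat.succ_ne_zero i), Nat.add_sub_cancel,
          Finset.Icc_eq_empty (by omega), Finset.sum_empty]
  · push Not at hu
    obtain ⟨i, hi, hlt⟩ := hu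
    have hc := le_colLen_of_rank hd hi
    rw [Finset.prod_eq_zero (Finset.mem_range.2 hi), Finset.prod_eq_zero (Finset.mem_range.2 hi)]
    · rw [innerRows, Finset.Icc_eq_empty (by omega), Finset.sum_empty]
    · rw [outerRows, Finset.Icc_eq_empty (by omega), Finset.sum_empty]

end GeneratingFunctions

theorem balanced_isThreshold : Balanced IsThreshold VStrip where
  bot := isThreshold_bot
  card_le μ lam hl hs := by
    obtain ⟨d, hd⟩ := exists_rank μ
    rw [card_eq_sum_hooks (outer_notMem hd hl hs),
      card_eq_sum_hooks (μ := μ) (d := d) (by rw [hd]; omega), Finset.mul_sum]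
    refine Finset.sum_le_sum fun i hi => ?_
    have hi := Finset.mem_range.1 hi
    obtain ⟨h1, h2⟩ := outer_bounds hd hl hs hi
    rw [outerRows, Finset.mem_Icc] at h2
    have h3 := le_rowLen_of_rank hd hi
    have h4 := le_colLen_of_rank hd hi
    omega
  card_eq μ a b hab := by
    by_cases ha : μ.card ≤ a
    · obtain ⟨d, hd⟩ := exists_rank μ
      obtain ⟨k, rfl⟩ := Nat.exists_eq_add_of_le ha
      rw [card_outer_eq hd, card_inner_eq hd (k := k) (by omega), ← Nat.cast_inj (R := ℤ)]
      have h1 := coeff_prod_sum_X_pow (fun i : Fin d => outerRows μ i)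
        (fun i a => (a - μ.rowLen i) + (a + 1 - μ.colLen i)) k
      have h2 := coeff_prod_sum_X_pow (fun i : Fin d => innerRows μ i)
        (fun i a => (μ.rowLen i - a) + (μ.colLen i - (a + 1))) k
      rw [← h1, ← h2, prod_outer_eq_prod_inner hd]
    · rw [Finset.card_eq_zero.2, Finset.card_eq_zero.2]
      · refine Finset.filter_eq_empty_iff.2 ?_
        rintro ν hν ⟨-, h2⟩
        have := h2.card_le
        rw [mem_partitionsOf] at hν
        omega
      · refine Finset.filter_eq_empty_iff.2 ?_
        rintro lam hlam ⟨-, h2⟩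
        have := h2.card_le
        rw [mem_partitionsOf] at hlam
        omega

/-! ### Evaluation of symmetric functions -/

section Eval

open MvPolynomial

variable {K : Type*} [CommRing K]

/-- The sequence of the variables `x_0, …, x_{n-1}`, extended by zero. -/
def varSeq (K : Type*) [CommRing K] (n : ℕ) (i : ℕ) : MvPolynomial (Fin n) K :=
  if h : i < n then X ⟨i, h⟩ else 0

theorem schurPoly_eq_schurVal (n : ℕ) (μ : YoungDiagram) :
    schurPoly K n μ = schurVal (varSeq K n) n μ := by
  rw [schurPoly, schurVal]
  refine Finset.sum_congr rfl fun T _ => ?_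
  rw [← Finset.prod_coe_sort μ.cells fun c => varSeq K n (T.1 c.1 c.2)]
  refine Finset.prod_congr rfl fun c _ => ?_
  rw [varSeq, dif_pos (T.2 _ _ c.2)]

theorem psum_eq_powSums (n : ℕ) (r : ℕ+) : psum (Fin n) K r = powSums (varSeq K n) n r := by
  rw [psum, powSums, ← Fin.sum_univ_eq_sum_range (fun i => varSeq K n i ^ (r : ℕ))]
  refine Finset.sum_congr rfl fun i _ => ?_
  rw [varSeq, dif_pos i.2]

@[simp]
theorem evalVars_X (n : ℕ) (r : ℕ+) : evalVars K n (X r) = powSums (varSeq K n) n r := by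
  rw [evalVars, aeval_X, psum_eq_powSums]

/-- The standard involution of `Λ`, which maps `p_r` to `(-1)^(r-1) p_r`. -/
def omega (K : Type*) [CommRing K] : SymmRing K →ₐ[K] SymmRing K :=
  aeval fun r => (-1) ^ ((r : ℕ) + 1) * X r

theorem evalVars_omegaSeq (n : ℕ) (φ : ℕ+ → SymmRing K) :
    (fun r => evalVars K n (omegaSeq φ r)) = omegaSeq fun r => evalVars K n (φ r) := by
  ext1 r
  simp [omegaSeq]

variable [Algebra ℚ K]

theorem evalVars_hsym (n : ℕ) (φ : ℕ+ → SymmRing K) (k : ℕ) :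
    evalVars K n (hsym φ k) = hsym (fun r => evalVars K n (φ r)) k :=
  map_hsym (evalVars K n : SymmRing K →+* MvPolynomial (Fin n) K) φ k

theorem omega_hsym (k : ℕ) : omega K (hsym X k) = hsym (omegaSeq X) k := by
  have h := map_hsym (omega K : SymmRing K →+* SymmRing K) X k
  refine Eq.trans h ?_
  congr 1
  ext1 r
  simp [omega, omegaSeq]

theorem evalVars_elementary (n k : ℕ) :
    evalVars K n (hsym (omegaSeq X) k) = esymm (Fin n) K k := by
  rw [evalVars_hsym, evalVars_omegaSeq]
  symm
  refine eq_hsym (g := fun k => esymm (Fin n) K k) (by simp) (fun k => ?_) k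
  have h := mul_esymm_eq_sum (Fin n) K (k + 1)
  rw [Nat.cast_add, Nat.cast_one] at h
  rw [h, Finset.sum_filter, Finset.Nat.sum_antidiagonal_eq_sum_range_succ_mk,
    Finset.sum_range_succ, if_neg (by simp), add_zero, Finset.mul_sum]
  refine Finset.sum_congr rfl fun i hi => ?_
  have hi := Finset.mem_range.1 hi
  rw [if_pos hi, omegaSeq, evalVars_X, ← psum_eq_powSums]
  have e : ((Nat.succPNat (k - i) : ℕ+) : ℕ) = k + 1 - i := by
    rw [Nat.succPNat_coe]
    omega
  rw [e]
  have e3 : (-1 : MvPolynomial (Fin n) K) ^ (k + 1 + 1) * (-1) ^ i = (-1) ^ (k + 1 - i + 1) := by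
    rw [← pow_add, show k + 1 + 1 + i = (k + 1 - i + 1) + 2 * i by omega, pow_add, pow_mul]
    simp
  rw [← e3]
  ring

/-- In Newton's recursion for the elementary functions the newest power sum occurs with coefficient
`±1`, so it can be solved for inductively. -/
theorem aeval_elementary_surjective : Function.Surjective
    (aeval (fun k : ℕ+ => hsym (omegaSeq X) k) : MvPolynomial ℕ+ K →ₐ[K] SymmRing K) := by
  rw [← AlgHom.range_eq_top]
  have hX : ∀ k : ℕ, (X (Nat.succPNat k) : SymmRing K) ∈
      (aeval (fun k : ℕ+ => hsym (omegaSeq X) k) : MvPolynomial ℕ+ K →ₐ[K] SymmRing K).range := by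
    intro k
    induction k using Nat.strong_induction_on with
    | _ k ih =>
      set A := (aeval (fun k : ℕ+ => hsym (omegaSeq X) k) :
        MvPolynomial ℕ+ K →ₐ[K] SymmRing K).range
      have he : ∀ k : ℕ, hsym (omegaSeq (X : ℕ+ → SymmRing K)) (k + 1) ∈ A :=
        fun k => ⟨X (Nat.succPNat k), by simp⟩
      have hs : ∀ m : ℕ, (-1 : SymmRing K) ^ m ∈ A := fun m =>
        A.pow_mem (A.neg_mem A.one_mem) m
      have h := succ_mul_hsym (omegaSeq (X : ℕ+ → SymmRing K)) k
      rw [Finset.sum_range_succ', hsym_zero, mul_one, Nat.sub_zero] at h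
      have h1 : omegaSeq (X : ℕ+ → SymmRing K) (Nat.succPNat k) ∈ A := by
        rw [← sub_eq_iff_eq_add'] at h
        rw [← h]
        refine A.sub_mem (A.mul_mem (A.add_mem (natCast_mem A k) A.one_mem) (he k)) ?_
        refine A.sum_mem fun i hi => A.mul_mem (A.mul_mem (hs _) (ih _ ?_)) (he i)
        have := Finset.mem_range.1 hi
        omega
      have h2 : (X (Nat.succPNat k) : SymmRing K) =
          (-1) ^ ((Nat.succPNat k : ℕ) + 1) * omegaSeq X (Nat.succPNat k) := by
        rw [omegaSeq, ← mul_assoc, ← pow_add, Even.neg_one_pow ⟨_, rfl⟩, one_mul]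
      rw [h2]
      exact A.mul_mem (hs _) h1
  rw [eq_top_iff, ← MvPolynomial.adjoin_range_X, Algebra.adjoin_le_iff]
  rintro _ ⟨r, rfl⟩
  rw [← PNat.succPNat_natPred r]
  exact hX _

/-- Written in elementary functions, `f` involves only `e_1, …, e_n` for some `n`, and these remain
algebraically independent in `n` variables. -/
theorem eq_zero_of_evalVars {f : SymmRing K} (h : ∀ n, evalVars K n f = 0) : f = 0 := by
  obtain ⟨g, rfl⟩ := aeval_elementary_surjective f
  obtain ⟨n, hn⟩ : ∃ n : ℕ, ∀ r ∈ g.vars, (r : ℕ) ≤ n :=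
    ⟨g.vars.sup fun r => (r : ℕ), fun r hr => Finset.le_sup (f := fun r : ℕ+ => (r : ℕ)) hr⟩
  obtain ⟨q, rfl⟩ := exists_rename_eq_of_vars_subset_range g
    (fun i : Fin n => Nat.succPNat i) (fun i j hij => Fin.ext (Nat.succPNat_injective hij)) (by
      intro r hr
      have h1 := hn r hr
      have h2 := r.pos
      refine ⟨⟨r.natPred, ?_⟩, PNat.succPNat_natPred r⟩
      rw [PNat.natPred]
      omega)
  have h1 := h n
  rw [aeval_rename, comp_aeval_apply] at h1
  have h2 : (esymmAlgHom (Fin n) K n q).val = 0 := by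
    rw [esymmAlgHom_apply, ← h1]
    congr 2
    ext1 i
    rw [Function.comp_apply, evalVars_elementary, Nat.succPNat_coe]
  have h3 : q = 0 := by
    apply esymmAlgHom_injective (σ := Fin n) K (n := n) (by simp)
    rw [map_zero]
    exact Subtype.ext h2
  rw [h3, map_zero, map_zero]

theorem ext_evalVars {f g : SymmRing K} (h : ∀ n, evalVars K n f = evalVars K n g) : f = g := by
  rw [← sub_eq_zero]
  apply eq_zero_of_evalVars
  intro n
  rw [map_sub, h, sub_self]

end Eval

/-! ### Schur functions and the involution -/

/-- With `ν` obtained by deleting the last row of `lam`, of length `k`, every other `κ` in the Pieri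
expansion of `h_k s_ν` has a shorter row in that position. The induction is on the number of rows,
then on the length of the last one. -/
theorem pieri_induction {P : YoungDiagram → Prop} (bot : P ⊥)
    (step : ∀ ν k lam, lam.card = ν.card + k → HStrip ν lam → P ν →
      (∀ κ, κ.card = ν.card + k → HStrip ν κ → κ ≠ lam → P κ) → P lam)
    (lam : YoungDiagram) : P lam := by
  suffices h : ∀ N, ∀ lam : YoungDiagram, lam.rowLen N = 0 → P lam from h _ lam (rowLen_card lam)
  intro N
  induction N with
  | zero =>
    intro lam h
    have : lam = ⊥ := ext_rowLen fun i => by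
      rw [rowLen_eq_zero_of_le h (Nat.zero_le i), rowLen_bot]
    rw [this]
    exact bot
  | succ N ihN =>
    intro lam h
    induction hm : lam.rowLen N using Nat.strong_induction_on generalizing lam with
    | _ m ihm =>
      subst hm
      let f : ℕ → ℕ := fun i => if i < N then lam.rowLen i else 0
      have hr : ∀ i, (mkRows f).rowLen i = f i := by
        apply rowLen_mkRows (N := N)
        · intro i
          have := lam.rowLen_anti i (i + 1) (Nat.le_succ i)
          simp only [f]
          split_ifs <;> omega
        · simp [f]
      have hz : (mkRows f).rowLen N = 0 := by simp [hr, f]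
      have hs : HStrip (mkRows f) lam := by
        intro i
        rw [hr]
        simp only [f]
        split_ifs with hi
        · exact ⟨le_rfl, lam.rowLen_anti i (i + 1) (Nat.le_succ i)⟩
        · exact ⟨Nat.zero_le _, (rowLen_eq_zero_of_le h (by omega)).le⟩
      have hc : lam.card = (mkRows f).card + lam.rowLen N := by
        rw [card_eq_sum_rowLen _ h, card_eq_sum_rowLen _ hz, Finset.sum_range_succ]
        congr 1
        refine Finset.sum_congr rfl fun i hi => ?_
        rw [hr]
        simp only [f]
        rw [if_pos (Finset.mem_range.1 hi)]
      refine step (mkRows f) (lam.rowLen N) lam hc hs (ihN _ hz) fun κ hκ hsκ hne => ?_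
      have hκz : κ.rowLen (N + 1) = 0 := by
        have := (hsκ N).2
        omega
      refine ihm (κ.rowLen N) ?_ κ hκz rfl
      by_contra hlt
      apply hne
      -- If that row of `κ` were not shorter, `κ` would contain `lam`; having the same size, it
      -- would equal `lam`.
      have hle : ∀ i ∈ Finset.range (N + 1), lam.rowLen i ≤ κ.rowLen i := by
        intro i hi
        have hi := Finset.mem_range.1 hi
        by_cases hiN : i < N
        · have := (hsκ i).1
          rw [hr] at this
          simp only [f] at this
          rwa [if_pos hiN] at this
        · have : i = N := by omega
          rw [this]
          exact not_lt.1 hlt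
      have heq := (Finset.sum_eq_sum_iff_of_le hle).1
        (by rw [← card_eq_sum_rowLen _ h, ← card_eq_sum_rowLen _ hκz, hκ, hc])
      apply ext_rowLen
      intro i
      by_cases hi : i < N + 1
      · exact (heq i (Finset.mem_range.2 hi)).symm
      · rw [rowLen_eq_zero_of_le h (not_lt.1 hi), rowLen_eq_zero_of_le hκz (not_lt.1 hi)]

section Schur

open MvPolynomial

variable {K : Type*} [CommRing K] [Algebra ℚ K]

theorem sum_transpose_hStrip {M : Type*} [AddCommMonoid M] (ν : YoungDiagram) (m : ℕ)
    (g : YoungDiagram → M) :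
    ∑ μ ∈ partitionsOf m with VStrip ν.transpose μ, g μ =
      ∑ μ ∈ partitionsOf m with HStrip ν μ, g μ.transpose := by
  refine Finset.sum_bij' (fun μ _ => μ.transpose) (fun μ _ => μ.transpose) ?_ ?_ ?_ ?_ ?_
  · intro μ h
    simp only [Finset.mem_filter, mem_partitionsOf, card_transpose] at h ⊢
    rw [← vStrip_transpose, YoungDiagram.transpose_transpose]
    exact h
  · intro μ h
    simp only [Finset.mem_filter, mem_partitionsOf, card_transpose] at h ⊢
    rw [vStrip_transpose]
    exact h
  · exact fun μ _ => YoungDiagram.transpose_transpose μ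
  · exact fun μ _ => YoungDiagram.transpose_transpose μ
  · intro μ _
    rw [YoungDiagram.transpose_transpose]

/-- Pieri's rule is solved for `s_lam`. Since `omega` has no direct description in terms of
variables, its image is carried along: `omega` turns Pieri's rule into the dual one, with all shapes
transposed. -/
theorem exists_schur (K : Type*) [CommRing K] [Algebra ℚ K] (lam : YoungDiagram) :
    ∃ f : SymmRing K, (∀ n, evalVars K n f = schurPoly K n lam) ∧
      ∀ n, evalVars K n (omega K f) = schurPoly K n lam.transpose := by
  induction lam using pieri_induction with
  | bot => exact ⟨1, by simp [schurPoly_eq_schurVal], by simp [schurPoly_eq_schurVal]⟩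
  | step ν k lam hc hs hν ih =>
    obtain ⟨f, hf1, hf2⟩ := hν
    -- The conditions on `κ` move inside the existential, with default `0`, so that a single
    -- function `g` can be chosen.
    have ih' : ∀ κ : YoungDiagram, ∃ g : SymmRing K, κ.card = ν.card + k → HStrip ν κ → κ ≠ lam →
        (∀ n, evalVars K n g = schurPoly K n κ) ∧
          ∀ n, evalVars K n (omega K g) = schurPoly K n κ.transpose := by
      intro κ
      by_cases h : κ.card = ν.card + k ∧ HStrip ν κ ∧ κ ≠ lam
      · obtain ⟨g, hg⟩ := ih κ h.1 h.2.1 h.2.2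
        exact ⟨g, fun _ _ _ => hg⟩
      · exact ⟨0, fun h1 h2 h3 => absurd ⟨h1, h2, h3⟩ h⟩
    choose g hg using ih'
    have hmem : lam ∈ (partitionsOf (ν.card + k)).filter fun κ => HStrip ν κ :=
      Finset.mem_filter.2 ⟨mem_partitionsOf.2 hc, hs⟩
    have hg' : ∀ κ ∈ ((partitionsOf (ν.card + k)).filter fun κ => HStrip ν κ).erase lam,
        (∀ n, evalVars K n (g κ) = schurPoly K n κ) ∧
          ∀ n, evalVars K n (omega K (g κ)) = schurPoly K n κ.transpose := by
      intro κ hκ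
      rw [Finset.mem_erase, Finset.mem_filter, mem_partitionsOf] at hκ
      exact hg κ hκ.2.1 hκ.2.2 hκ.1
    refine ⟨hsym X k * f -
      ∑ κ ∈ ((partitionsOf (ν.card + k)).filter fun κ => HStrip ν κ).erase lam, g κ,
      fun n => ?_, fun n => ?_⟩
    · rw [map_sub, map_mul, map_sum, hf1, Finset.sum_congr rfl fun κ hκ => (hg' κ hκ).1 n,
        evalVars_hsym]
      simp only [evalVars_X, schurPoly_eq_schurVal]
      rw [hsym_mul_schurVal, sub_eq_iff_eq_add, Finset.add_sum_erase _ _ hmem]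
    · rw [map_sub, map_mul, map_sum, map_sub, map_mul, map_sum, hf2,
        Finset.sum_congr rfl fun κ hκ => (hg' κ hκ).2 n, omega_hsym, evalVars_hsym,
        evalVars_omegaSeq]
      simp only [evalVars_X, schurPoly_eq_schurVal]
      rw [hsym_omegaSeq_mul_schurVal, sub_eq_iff_eq_add,
        Finset.add_sum_erase _ (fun κ : YoungDiagram => schurVal (varSeq K n) n κ.transpose) hmem,
        card_transpose, sum_transpose_hStrip]

theorem evalVars_schur (n : ℕ) (μ : YoungDiagram) :
    evalVars K n (schur K μ) = schurPoly K n μ := by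
  obtain ⟨f, hf, -⟩ := exists_schur K μ
  exact Classical.epsilon_spec (p := fun f => ∀ n, evalVars K n f = schurPoly K n μ) ⟨f, hf⟩ n

theorem schur_eq {μ : YoungDiagram} {f : SymmRing K}
    (h : ∀ n, evalVars K n f = schurPoly K n μ) : schur K μ = f :=
  ext_evalVars fun n => by rw [evalVars_schur, h]

theorem omega_schur (μ : YoungDiagram) : omega K (schur K μ) = schur K μ.transpose := by
  obtain ⟨f, h1, h2⟩ := exists_schur K μ
  rw [schur_eq h1, schur_eq h2]

theorem schur_rowShape (k : ℕ) : schur K (rowShape k) = hsym X k := by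
  apply schur_eq
  intro n
  rw [evalVars_hsym]
  simp only [evalVars_X]
  have h := hsym_mul_schurVal (varSeq K n) n k ⊥
  rw [schurVal_bot, mul_one, card_bot, zero_add] at h
  rw [h, schurPoly_eq_schurVal]
  refine Finset.sum_eq_single_of_mem _ ?_ ?_
  · rw [Finset.mem_filter, mem_partitionsOf, hStrip_bot, card_rowShape]
    exact ⟨rfl, rfl⟩
  · intro μ hμ hne
    rw [Finset.mem_filter, mem_partitionsOf, hStrip_bot] at hμ
    rw [hμ.1] at hμ
    exact absurd hμ.2 hne

theorem schur_colShape (k : ℕ) : schur K (colShape k) = hsym (omegaSeq X) k := by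
  rw [← transpose_rowShape, ← omega_schur, schur_rowShape, omega_hsym]

/-! ### Plethysm with functions of degree two -/

theorem plethysm_hsym (φ : ℕ+ → SymmRing K) (g : SymmRing ℚ) (h : ℕ) :
    plethysm (hsym φ h) g = hsym (fun r => plethysm (φ r) g) h :=
  map_hsym ((aeval fun r => MvPolynomial.map (algebraMap ℚ K) (powerPlethysm r g) :
    SymmRing K →ₐ[K] SymmRing K) : SymmRing K →+* SymmRing K) φ h

theorem plethysm_X (r : ℕ+) (g : SymmRing ℚ) :
    plethysm (X r : SymmRing K) g = MvPolynomial.map (algebraMap ℚ K) (powerPlethysm r g) := by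
  rw [plethysm, aeval_X]

theorem plethysm_omegaSeq_X (g : SymmRing ℚ) :
    (fun r => plethysm (omegaSeq (X : ℕ+ → SymmRing K) r) g) =
      omegaSeq fun r => plethysm (X r) g := by
  ext1 r
  simp [plethysm, omegaSeq]

theorem map_smul_rat (q : ℚ) (f : SymmRing ℚ) :
    MvPolynomial.map (algebraMap ℚ K) (q • f) = q • MvPolynomial.map (algebraMap ℚ K) f := by
  rw [smul_eq_C_mul, map_mul, map_C, Algebra.smul_def]
  rfl

theorem plethysm_X_rowShape (r : ℕ+) : plethysm (X r : SymmRing K) (schur ℚ (rowShape 2)) =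
    (2 : ℚ)⁻¹ • (X r ^ 2 + X (r * 2)) := by
  rw [plethysm_X, schur_rowShape, hsym_two, map_smul, map_smul_rat]
  simp [powerPlethysm]

theorem plethysm_X_colShape (r : ℕ+) : plethysm (X r : SymmRing K) (schur ℚ (colShape 2)) =
    (2 : ℚ)⁻¹ • (X r ^ 2 - X (r * 2)) := by
  rw [plethysm_X, schur_colShape, hsym_two, map_smul, map_smul_rat]
  simp [powerPlethysm, omegaSeq, sub_eq_add_neg, pow_succ]

/-- It suffices to look at `p_r[s_{1^2}] = (p_r² - p_{2r}) / 2`: the involution fixes `p_r²` and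
negates `p_{2r}`, giving `p_r[s_2]`. -/
theorem omega_plethysm_colShape (f : SymmRing K) :
    omega K (plethysm f (schur ℚ (colShape 2))) = plethysm f (schur ℚ (rowShape 2)) := by
  have h : ∀ r : ℕ+, omega K (plethysm (X r : SymmRing K) (schur ℚ (colShape 2))) =
      plethysm (X r : SymmRing K) (schur ℚ (rowShape 2)) := by
    intro r
    rw [plethysm_X_colShape, plethysm_X_rowShape, map_rat_smul]
    congr 1
    have h1 : ((-1 : SymmRing K) ^ ((r : ℕ) + 1)) ^ 2 = 1 := by
      rw [← pow_mul, mul_comm, pow_mul]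
      simp
    have h2 : (-1 : SymmRing K) ^ ((r * 2 : ℕ+) : ℕ) = 1 := by
      rw [PNat.mul_coe, mul_comm, PNat.val_ofNat, pow_mul]
      simp
    rw [map_sub, map_pow, omega, aeval_X, aeval_X, mul_pow, h1, pow_succ _ ((r * 2 : ℕ+) : ℕ), h2]
    ring
  simp only [plethysm_X] at h
  rw [plethysm, comp_aeval_apply, plethysm]
  congr 2
  ext1 r
  exact h r

/-! ### Evaluation at products of two variables, and the identities for `s_{1^2}` -/

theorem two_mul_pairPowSums {R : Type*} [CommRing R] (x : ℕ → R) (n : ℕ) (r : ℕ+) :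
    2 * pairPowSums x n r = powSums x n r ^ 2 - powSums x n (r * 2) := by
  induction n with
  | zero => simp [pairPowSums, powSums]
  | succ n ih =>
    rw [pairPowSums_succ, mul_add, ih, powSums, powSums, powSums, powSums, Finset.sum_range_succ,
      Finset.sum_range_succ, PNat.mul_coe, PNat.val_ofNat, pow_mul]
    ring

theorem evalVars_plethysm_colShape (n : ℕ) (r : ℕ+) :
    evalVars K n (plethysm (X r : SymmRing K) (schur ℚ (colShape 2))) =
      pairPowSums (varSeq K n) n r := by
  rw [plethysm_X_colShape, map_rat_smul, map_sub, map_pow, evalVars_X, evalVars_X,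
    ← two_mul_pairPowSums, Algebra.smul_def, ← mul_assoc]
  have : (2 : MvPolynomial (Fin n) K) = algebraMap ℚ _ 2 := (map_ofNat _ 2).symm
  rw [this, ← map_mul, inv_mul_cancel₀ two_ne_zero, map_one, one_mul]

theorem hsym_plethysm_colShape (h : ℕ) :
    plethysm (schur K (rowShape h)) (schur ℚ (colShape 2)) =
      ∑ μ ∈ partitionsOf (2 * h) with IsEven μ, schur K μ := by
  apply ext_evalVars
  intro n
  rw [schur_rowShape, plethysm_hsym, evalVars_hsym, map_sum]
  simp only [evalVars_plethysm_colShape, evalVars_schur, schurPoly_eq_schurVal]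
  have := littlewood balanced_isEven (fun _ => 1) (varSeq K n)
    (by simpa only [one_mul] using hsym_mul_schurVal (varSeq K n)) n h
  simpa only [one_mul] using this

theorem elementary_plethysm_colShape (h : ℕ) :
    plethysm (schur K (colShape h)) (schur ℚ (colShape 2)) =
      ∑ μ ∈ partitionsOf (2 * h) with IsThreshold μ, schur K μ := by
  apply ext_evalVars
  intro n
  rw [schur_colShape, plethysm_hsym, plethysm_omegaSeq_X, evalVars_hsym, evalVars_omegaSeq,
    map_sum]
  simp only [evalVars_plethysm_colShape, evalVars_schur, schurPoly_eq_schurVal]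
  exact littlewood balanced_isThreshold (fun r => (-1) ^ ((r : ℕ) + 1)) (varSeq K n)
    (hsym_omegaSeq_mul_schurVal (varSeq K n)) n h

end Schur

end SymmFunc

end

open SymmFunc in
open scoped Classical in
theorem mainTheorem2 (K : Type*) [CommRing K] [Algebra ℚ K] (h : ℕ) :
    plethysm (schur K (rowShape h)) (schur ℚ (rowShape 2)) =
        ∑ μ ∈ partitionsOf (2 * h) with IsEven μ, schur K μ.transpose ∧
    plethysm (schur K (rowShape h)) (schur ℚ (colShape 2)) =
        ∑ μ ∈ partitionsOf (2 * h) with IsEven μ, schur K μ ∧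
    plethysm (schur K (colShape h)) (schur ℚ (rowShape 2)) =
        ∑ μ ∈ partitionsOf (2 * h) with IsThreshold μ, schur K μ.transpose ∧
    plethysm (schur K (colShape h)) (schur ℚ (colShape 2)) =
        ∑ μ ∈ partitionsOf (2 * h) with IsThreshold μ, schur K μ := by
  refine ⟨?_, hsym_plethysm_colShape h, ?_, elementary_plethysm_colShape h⟩
  -- The identities for `s_2` are the images under `omega` of those for `s_{1^2}`; the outer
  -- function is unchanged because the inner one has even degree.
  · rw [← omega_plethysm_colShape, hsym_plethysm_colShape, map_sum]
    simp only [omega_schur]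
  · rw [← omega_plethysm_colShape, elementary_plethysm_colShape, map_sum]
    simp only [omega_schur]
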